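/- **Setting.** Let $m\ge 1$, $n\ge 1$, $r\ge 0$, let $P(\lambda)=\sum_{j=0}^m\lambda^jA_j$ with $A_j\in\mathbb C^{n\times n}$, $A_m\ne 0$, and let $G(\lambda)=P(\lambda)+C(\lambda E-A)^{-1}B$ be a minimal realization, i.e. $E\in\mathbb C^{r\times r}$ is nonsingular, $A\in\mathbb C^{r\times r}$, $B\in\mathbb C^{r\times n}$, $C\in\mathbb C^{n\times r}$, and $r$ is smallest among all realizations of $G$ of this form. Put $\mathcal S(\lambda)=\begin{bmatrix}P(\lambda)&C\\ B&A-\lambda E\end{bmatrix}$. Let $e_k$ be the $k$-th column of $I_m$. **Elementary and Fiedler matrices.** For $X\in\mathbb C^{n\times n}$ let $M_0(X)=\mathrm{diag}(I_{(m-1)n},X)$, $M_{-m}(X)=\mathrm{diag}(X,I_{(m-1)n})$ and, for $1\le i\le m-1$, $$M_i(X)=\mathrm{diag}\Big(I_{(m-i-1)n},\begin{bmatrix}X&I_n\\I_n&0\end{bmatrix},I_{(i-1)n}\Big),\qquad M_{-i}(X)=\mathrm{diag}\Big(I_{(m-i-1)n},\begin{bmatrix}0&I_n\\I_n&X\end{bmatrix},I_{(i-1)n}\Big).$$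 Put $\mathbb M_i(X)=\mathrm{diag}(M_i(X),I_r)$ for $-m\le i\le m-1$, and $$\mathbb M^{\mathcal S}_0=\begin{bmatrix}M_0(-A_0)&-e_m\otimes C\\-e_m^T\otimes B&-A\end{bmatrix},\quad \mathbb M^{\mathcal S}_{-m}=\mathrm{diag}(M_{-m}(A_m),-E),\quad \mathbb M^{\mathcal S}_i=\mathrm{diag}(M_i(-A_i),I_r),\quad \mathbb M^{\mathcal S}_{-i}=(\mathbb M^{\mathcal S}_i)^{-1}\quad(1\le i\le m-1).$$ For a tuple of indices $\mathbf t=(t_1,\dots,t_k)$ put $\mathbb M^{\mathcal S}_{\mathbf t}=\mathbb M^{\mathcal S}_{t_1}\cdots\mathbb M^{\mathcal S}_{t_k}$ and, for a tuple $X=(X_1,\dots,X_k)$ of $n\times n$ matrices (a matrix assignment for $\mathbf t$), $\mathbb M_{\mathbf t}(X)=\mathbb M_{t_1}(X_1)\cdots\mathbb M_{t_k}(X_k)$. The assignment is nonsingular if $X_j$ is nonsingular whenever $t_j\in\{0,-m\}$. **Index tuples.** A tuple satisfies the successor infix property (SIP) if between any two occurrences of an index $i$ there is an occurrence of $i+1$.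 A subtuple is obtained by deleting entries. For a tuple $\alpha$ containing $0$, $c_0(\alpha)$ is the largest $p$ such that $(0,1,\dots,p)$ is a subtuple of $\alpha$, and $i_0(\alpha)$ the largest $p$ such that $(p,\dots,1,0)$ is a subtuple of $\alpha$. For a permutation $\alpha$ of $\{0,\dots,m-1\}$, $c(\alpha)$ (resp. $i(\alpha)$) is the number of $i\in\{0,\dots,m-2\}$ that stand to the left (resp. to the right) of $i+1$ in $\alpha$. **GFPR.** Let $0\le h\le m-1$, let $\sigma$ and $\tau$ be permutations (as tuples) of $\{0,\dots,h\}$ and $\{-m,\dots,-h-1\}$, let $\sigma_1,\sigma_2$ be tuples of indices from $\{0,\dots,h-1\}$ and $\tau_1,\tau_2$ tuples of indices from $\{-m,\dots,-h-2\}$ such that $(\sigma_1,\sigma,\sigma_2)$ and $(\tau_1,\tau,\tau_2)$ satisfy the SIP, and let $X_1,X_2,Y_1,Y_2$ be nonsingular matrix assignments for $\sigma_1,\sigma_2,\tau_1,\tau_2$. Let $$\mathbb L(\lambda)=\mathbb M_{\tau_1}(Y_1)\,\mathbb M_{\sigma_1}(X_1)\,(\lambda\mathbb M^{\mathcal S}_\tau-\mathbb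 M^{\mathcal S}_\sigma)\,\mathbb M_{\sigma_2}(X_2)\,\mathbb M_{\tau_2}(Y_2).$$ **Minimal bases.** For a matrix polynomial $M(\lambda)$, a right (resp. left) minimal basis is a matrix polynomial $Z(\lambda)$ whose columns, listed with nondecreasing degrees, form a basis of $\{x\in\mathbb C(\lambda)^k: Mx=0\}$ (resp. $\{y\in\mathbb C(\lambda)^k: y^TM=0\}$), $k$ being the number of columns (resp. rows) of $M$, with least sum of column degrees among all polynomial bases of that space; the degrees of its columns are the right (resp. left) minimal indices of $M$. **Theorem 5.3.** (a) Let $Z(\lambda)=\begin{bmatrix}Z_{mn}(\lambda)\\Z_r(\lambda)\end{bmatrix}$ be an $(mn+r)\times p$ matrix polynomial, where $Z_{mn}$ has $mn$ rows and $Z_r$ has $r$ rows. If $Z$ is a right (resp. left) minimal basis of $\mathbb L(\lambda)$, then $$\begin{bmatrix}(e^T_{m-c_0(\sigma,\sigma_2)}\otimes I_n)Z_{mn}(\lambda)\\ Z_r(\lambda)\end{bmatrix}\qquad\Big(\text{resp. }\begin{bmatrix}(e^T_{m-i_0(\sigma_1,\sigma)}\otimes I_n)Z_{mn}(\lambda)\\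 Z_r(\lambda)\end{bmatrix}\Big)$$ is a right (resp. left) minimal basis of $\mathcal S(\lambda)$. (b) Write $\tau=(\tau_l,-m,\tau_r)$ and $\alpha=(-\mathrm{rev}\,\tau_l,\ \sigma,\ -\mathrm{rev}\,\tau_r)$, where $\mathrm{rev}$ reverses a tuple; $\alpha$ is a permutation of $\{0,\dots,m-1\}$. If $\varepsilon_1\le\dots\le\varepsilon_p$ are the right (resp. left) minimal indices of $\mathbb L(\lambda)$, then $\varepsilon_1-i(\alpha)\le\dots\le\varepsilon_p-i(\alpha)$ (resp. $\varepsilon_1-c(\alpha)\le\dots\le\varepsilon_p-c(\alpha)$) are the right (resp. left) minimal indices of $\mathcal S(\lambda)$. -/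

import Mathlib

open Polynomial

namespace GFPR

noncomputable section

/-! ### Null spaces, polynomial bases, minimal bases and minimal indices -/

/-- A matrix polynomial, viewed as a rational matrix. -/
def toRat {ι κ : Type*} (M : Matrix ι κ ℂ[X]) : Matrix ι κ (RatFunc ℂ) :=
  M.map (algebraMap ℂ[X] (RatFunc ℂ))

/-- The right null space `{x | G x = 0}` of a rational matrix over the field `ℂ(λ)`. -/
def rightNull {ι κ : Type*} [Fintype ι] [Fintype κ] (G : Matrix ι κ (RatFunc ℂ)) :
    Submodule (RatFunc ℂ) (κ → RatFunc ℂ) :=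
  LinearMap.ker G.mulVecLin

/-- The left null space `{y | yᵀ G = 0}` of a rational matrix over the field `ℂ(λ)`. -/
def leftNull {ι κ : Type*} [Fintype ι] [Fintype κ] (G : Matrix ι κ (RatFunc ℂ)) :
    Submodule (RatFunc ℂ) (ι → RatFunc ℂ) :=
  LinearMap.ker G.vecMulLinear

/-- The degree of the `j`-th column of a matrix polynomial: the largest degree of its entries. -/
def colDegree {κ : Type*} [Fintype κ] {p : ℕ} (Z : Matrix κ (Fin p) ℂ[X]) (j : Fin p) : ℕ :=
  Finset.univ.sup fun k => (Z k j).natDegree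

/-- The columns of `Z` (vector polynomials) form a basis of the subspace `N` of `ℂ(λ)^κ`. -/
def IsPolynomialBasis {κ : Type*} (N : Submodule (RatFunc ℂ) (κ → RatFunc ℂ)) {p : ℕ}
    (Z : Matrix κ (Fin p) ℂ[X]) : Prop :=
  LinearIndependent (RatFunc ℂ) (fun j : Fin p => (toRat Z).col j) ∧
    Submodule.span (RatFunc ℂ) (Set.range fun j : Fin p => (toRat Z).col j) = N

/-- The order of a polynomial basis: the sum of the degrees of its members. -/
def order {κ : Type*} [Fintype κ] {p : ℕ} (Z : Matrix κ (Fin p) ℂ[X]) : ℕ :=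
  ∑ j, colDegree Z j

/-- The columns of `Z`, listed with nondecreasing degrees, form a polynomial basis of `N` whose
order is least among all polynomial bases of `N`. -/
structure IsMinimalBasis {κ : Type*} [Fintype κ] (N : Submodule (RatFunc ℂ) (κ → RatFunc ℂ))
    {p : ℕ} (Z : Matrix κ (Fin p) ℂ[X]) : Prop where
  basis : IsPolynomialBasis N Z
  sorted : Monotone (colDegree Z)
  order_le : ∀ (q : ℕ) (W : Matrix κ (Fin q) ℂ[X]), IsPolynomialBasis N W → order Z ≤ order W

/-- Right minimal basis of a matrix polynomial. -/
def IsRightMinimalBasis {ι κ : Type*} [Fintype ι] [Fintype κ] (M : Matrix ι κ ℂ[X]) {p : ℕ}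
    (Z : Matrix κ (Fin p) ℂ[X]) : Prop :=
  IsMinimalBasis (rightNull (toRat M)) Z

/-- Left minimal basis of a matrix polynomial. -/
def IsLeftMinimalBasis {ι κ : Type*} [Fintype ι] [Fintype κ] (M : Matrix ι κ ℂ[X]) {p : ℕ}
    (Z : Matrix ι (Fin p) ℂ[X]) : Prop :=
  IsMinimalBasis (leftNull (toRat M)) Z

/-- `ε 0 ≤ ε 1 ≤ ⋯` are the right minimal indices of `M`: the column degrees of a right minimal
basis. They are integer-valued so that differences are not truncated. -/
def IsRightMinimalIndices {ι κ : Type*} [Fintype ι] [Fintype κ] (M : Matrix ι κ ℂ[X]) {p : ℕ}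
    (ε : Fin p → ℤ) : Prop :=
  ∃ Z : Matrix κ (Fin p) ℂ[X], IsRightMinimalBasis M Z ∧ ∀ j, (colDegree Z j : ℤ) = ε j

/-- `ε 0 ≤ ε 1 ≤ ⋯` are the left minimal indices of `M`. -/
def IsLeftMinimalIndices {ι κ : Type*} [Fintype ι] [Fintype κ] (M : Matrix ι κ ℂ[X]) {p : ℕ}
    (ε : Fin p → ℤ) : Prop :=
  ∃ Z : Matrix ι (Fin p) ℂ[X], IsLeftMinimalBasis M Z ∧ ∀ j, (colDegree Z j : ℤ) = ε j

/-! ### Realizations and system matrices -/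

/-- The data of a realization `G(λ) = ∑_{j=0}^m λ^j A_j + C (λ E - A)⁻¹ B` with `E` nonsingular;
`A_j` is `coeff j`, and only `coeff 0, …, coeff m` are ever used. -/
structure Realization (m n r : ℕ) where
  coeff : ℕ → Matrix (Fin n) (Fin n) ℂ
  A : Matrix (Fin r) (Fin r) ℂ
  E : Matrix (Fin r) (Fin r) ℂ
  B : Matrix (Fin r) (Fin n) ℂ
  C : Matrix (Fin n) (Fin r) ℂ
  E_nonsingular : E.det ≠ 0

/-- A complex matrix as a constant matrix polynomial. -/
def const {ι κ : Type*} (M : Matrix ι κ ℂ) : Matrix ι κ ℂ[X] := M.map Polynomial.C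

namespace Realization

variable {m n r : ℕ}

/-- `P(λ) = ∑_{j=0}^m λ^j A_j`. -/
def polyPart (R : Realization m n r) : Matrix (Fin n) (Fin n) ℂ[X] :=
  ∑ j ∈ Finset.range (m + 1), (X ^ j : ℂ[X]) • const (R.coeff j)

/-- The rational matrix `P(λ) + C (λ E - A)⁻¹ B`. -/
def transfer (R : Realization m n r) : Matrix (Fin n) (Fin n) (RatFunc ℂ) :=
  toRat R.polyPart +
    toRat (const R.C) * (toRat ((X : ℂ[X]) • const R.E - const R.A))⁻¹ * toRat (const R.B)

/-- The realization has the least state dimension among all realizations of the same rational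
matrix. -/
def IsMinimal (R : Realization m n r) : Prop :=
  ∀ (m' r' : ℕ) (R' : Realization m' n r'), R'.transfer = R.transfer → r ≤ r'

/-- The system matrix `[P(λ), C; B, A - λ E]`. -/
def systemMatrix (R : Realization m n r) : Matrix (Fin n ⊕ Fin r) (Fin n ⊕ Fin r) ℂ[X] :=
  Matrix.fromBlocks R.polyPart (const R.C) (const R.B) (const R.A - (X : ℂ[X]) • const R.E)

end Realization

/-! ### Elementary matrices and Fiedler matrices -/

/-- `e_k ⊗ C`, where `e_k` is the `k`-th column (counted from 1) of the `m × m` identity. -/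
def blockCol (m : ℕ) {n : ℕ} {κ R : Type*} [Zero R] (k : ℤ) (C : Matrix (Fin n) κ R) :
    Matrix (Fin m × Fin n) κ R :=
  Matrix.of fun a j => if (a.1 : ℤ) + 1 = k then C a.2 j else 0

/-- `e_kᵀ ⊗ B`, where `e_k` is the `k`-th column (counted from 1) of the `m × m` identity. -/
def blockRow (m : ℕ) {n : ℕ} {κ R : Type*} [Zero R] (k : ℤ) (B : Matrix κ (Fin n) R) :
    Matrix κ (Fin m × Fin n) R :=
  Matrix.of fun j a => if (a.1 : ℤ) + 1 = k then B j a.2 else 0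

/-- The `m × m` array of `n × n` blocks of the elementary matrix `M_i(X)`, `-m ≤ i ≤ m - 1`.
For `i = 0` (`i = -m`) it is the identity with the last (first) diagonal block replaced by `X`.
For `0 < |i| < m` it is the identity except in the block rows and columns `m - |i|`, `m - |i| + 1`
(counted from 1), where it is `[X, I; I, 0]` if `i > 0` and `[0, I; I, X]` if `i < 0`. -/
def elemBlocks (m : ℕ) {n : ℕ} (i : ℤ) (X : Matrix (Fin n) (Fin n) ℂ) :
    Matrix (Fin m) (Fin m) (Matrix (Fin n) (Fin n) ℂ) :=
  if i = 0 then Matrix.diagonal fun a => if (a : ℕ) + 1 = m then X else 1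
  else if i = -(m : ℤ) then Matrix.diagonal fun a => if (a : ℕ) = 0 then X else 1
  else Matrix.of fun a b =>
    if (a : ℕ) + 1 + i.natAbs = m ∧ (b : ℕ) + 1 + i.natAbs = m then (if 0 < i then X else 0)
    else if (a : ℕ) + i.natAbs = m ∧ (b : ℕ) + i.natAbs = m then (if 0 < i then 0 else X)
    else if (a : ℕ) + 1 + i.natAbs = m ∧ (b : ℕ) + i.natAbs = m then 1
    else if (a : ℕ) + i.natAbs = m ∧ (b : ℕ) + 1 + i.natAbs = m then 1
    else if a = b then 1 else 0

/-- The `mn × mn` elementary matrix `M_i(X)`. -/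
def elem (m : ℕ) {n : ℕ} (i : ℤ) (X : Matrix (Fin n) (Fin n) ℂ) :
    Matrix (Fin m × Fin n) (Fin m × Fin n) ℂ :=
  Matrix.comp (Fin m) (Fin m) (Fin n) (Fin n) ℂ (elemBlocks m i X)

/-- The `(mn + r) × (mn + r)` elementary matrix `diag(M_i(X), I_r)`. -/
def bigElem (m : ℕ) {n : ℕ} (r : ℕ) (i : ℤ) (X : Matrix (Fin n) (Fin n) ℂ) :
    Matrix ((Fin m × Fin n) ⊕ Fin r) ((Fin m × Fin n) ⊕ Fin r) ℂ :=
  Matrix.fromBlocks (elem m i X) 0 0 1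

namespace Realization

variable {m n r : ℕ}

/-- The Fiedler matrix of `P(λ)`: `M_i(-A_i)` for `i ≥ 0` and `M_i(A_{-i})` for `i < 0`. -/
def fiedlerP (R : Realization m n r) (i : ℤ) : Matrix (Fin m × Fin n) (Fin m × Fin n) ℂ :=
  if 0 ≤ i then elem m i (-R.coeff i.natAbs) else elem m i (R.coeff i.natAbs)

/-- The Fiedler matrices of the system matrix: index `0` carries `B`, `C`, `A`, index `-m`
carries `E`, index `i = 1, …, m - 1` is `diag(M_i(-A_i), I_r)`, and index `-i` is its inverse. -/
def fiedlerS (R : Realization m n r) (i : ℤ) :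
    Matrix ((Fin m × Fin n) ⊕ Fin r) ((Fin m × Fin n) ⊕ Fin r) ℂ :=
  if i = 0 then
    Matrix.fromBlocks (R.fiedlerP 0) (-blockCol m (m : ℤ) R.C) (-blockRow m (m : ℤ) R.B) (-R.A)
  else if i = -(m : ℤ) then Matrix.fromBlocks (R.fiedlerP i) 0 0 (-R.E)
  else if 0 < i then Matrix.fromBlocks (R.fiedlerP i) 0 0 1
  else (Matrix.fromBlocks (R.fiedlerP (-i)) 0 0 1)⁻¹

/-- The product of the Fiedler matrices of the system matrix along an index tuple. -/
def fiedlerSProd (R : Realization m n r) (t : List ℤ) :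
    Matrix ((Fin m × Fin n) ⊕ Fin r) ((Fin m × Fin n) ⊕ Fin r) ℂ :=
  (t.map R.fiedlerS).prod

end Realization

/-- The product of the big elementary matrices along an index tuple `t` with the matrices of the
assignment `X` put in the corresponding positions. -/
def bigElemProd (m : ℕ) {n : ℕ} (r : ℕ) (t : List ℤ) (X : List (Matrix (Fin n) (Fin n) ℂ)) :
    Matrix ((Fin m × Fin n) ⊕ Fin r) ((Fin m × Fin n) ⊕ Fin r) ℂ :=
  (List.zipWith (bigElem m r) t X).prod

/-- `X` is a nonsingular matrix assignment for `t`: it has one matrix for each position of `t`,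
and the matrices in the positions occupied by the indices `0` and `-m` are nonsingular. -/
def IsNonsingularAssignment (m : ℕ) {n : ℕ} (t : List ℤ) (X : List (Matrix (Fin n) (Fin n) ℂ)) :
    Prop :=
  X.length = t.length ∧ ∀ q ∈ t.zip X, q.1 = 0 ∨ q.1 = -(m : ℤ) → q.2.det ≠ 0

/-! ### Index tuples -/

/-- The tuple `t` lists every integer of `{a, …, b}` exactly once and nothing else. -/
def IsPermutationOf (t : List ℤ) (a b : ℤ) : Prop :=
  t.Nodup ∧ ∀ i, i ∈ t ↔ a ≤ i ∧ i ≤ b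

/-- Successor infix property: between two occurrences of `i` there is an occurrence of `i + 1`. -/
def SIP (t : List ℤ) : Prop :=
  ∀ a b : Fin t.length, a < b → t.get a = t.get b →
    ∃ c : Fin t.length, a < c ∧ c < b ∧ t.get c = t.get a + 1

/-- The string `(t, t + 1, …, t + p)`. -/
def run (t : ℤ) (p : ℕ) : List ℤ := (List.range (p + 1)).map fun k => t + (k : ℤ)

/-- `c_t(α)`: the largest `p` such that `(t, t + 1, …, t + p)` is a subtuple of `α`, and `-1` if
`t` does not occur in `α`. -/
def consecutionsAt (t : ℤ) (α : List ℤ) : ℤ :=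
  if t ∈ α then (Nat.findGreatest (fun p => (run t p).Sublist α) α.length : ℤ) else -1

/-- `i_t(α)`: the largest `p` such that `(t + p, …, t + 1, t)` is a subtuple of `α`, and `-1` if
`t` does not occur in `α`. -/
def inversionsAt (t : ℤ) (α : List ℤ) : ℤ :=
  if t ∈ α then (Nat.findGreatest (fun p => (run t p).reverse.Sublist α) α.length : ℤ) else -1

/-- `c(α)`: the number of `i` such that `i` and `i + 1` both occur in the permutation `α`, with
`i` to the left of `i + 1`. -/
def totalConsecutions (α : List ℤ) : ℕ :=
  (α.toFinset.filter fun i => List.Sublist [i, i + 1] α).card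

/-- `i(α)`: the number of `i` such that `i` and `i + 1` both occur in the permutation `α`, with
`i` to the right of `i + 1`. -/
def totalInversions (α : List ℤ) : ℕ :=
  (α.toFinset.filter fun i => List.Sublist [i + 1, i] α).card

/-- `-rev(t)`. -/
def negRev (t : List ℤ) : List ℤ := t.reverse.map fun i => -i

/-! ### Generalized Fiedler pencils with repetition -/

/-- The conditions on the index tuples of a generalized Fiedler pencil with repetition. -/
structure IsGFPRIndices (m h : ℕ) (σ τ σ₁ σ₂ τ₁ τ₂ : List ℤ) : Prop where
  h_lt : h < m
  perm_σ : IsPermutationOf σ 0 h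
  perm_τ : IsPermutationOf τ (-(m : ℤ)) (-(h : ℤ) - 1)
  mem_σ₁ : ∀ i ∈ σ₁, 0 ≤ i ∧ i ≤ (h : ℤ) - 1
  mem_σ₂ : ∀ i ∈ σ₂, 0 ≤ i ∧ i ≤ (h : ℤ) - 1
  mem_τ₁ : ∀ i ∈ τ₁, -(m : ℤ) ≤ i ∧ i ≤ -(h : ℤ) - 2
  mem_τ₂ : ∀ i ∈ τ₂, -(m : ℤ) ≤ i ∧ i ≤ -(h : ℤ) - 2
  sip_σ : SIP (σ₁ ++ σ ++ σ₂)
  sip_τ : SIP (τ₁ ++ τ ++ τ₂)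

/-- The pencil `𝕄_{τ₁}(Y₁) 𝕄_{σ₁}(X₁) (λ 𝕄^S_τ - 𝕄^S_σ) 𝕄_{σ₂}(X₂) 𝕄_{τ₂}(Y₂)`. -/
def pencil {m n r : ℕ} (R : Realization m n r) (σ τ σ₁ σ₂ τ₁ τ₂ : List ℤ)
    (X₁ X₂ Y₁ Y₂ : List (Matrix (Fin n) (Fin n) ℂ)) :
    Matrix ((Fin m × Fin n) ⊕ Fin r) ((Fin m × Fin n) ⊕ Fin r) ℂ[X] :=
  const (bigElemProd m r τ₁ Y₁) * const (bigElemProd m r σ₁ X₁) *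
    ((X : ℂ[X]) • const (R.fiedlerSProd τ) - const (R.fiedlerSProd σ)) *
    const (bigElemProd m r σ₂ X₂) * const (bigElemProd m r τ₂ Y₂)

end

end GFPR

open GFPR

/-!
Since `𝕄^S_{-i} = (𝕄^S_i)⁻¹`, the pencil factors as `P (λ 𝕄^S_{-m} - 𝕄^S_α) Q` with constant
nonsingular `P` and `Q`, so it suffices to describe the null vectors of the Fiedler pencil of the
permutation `α`. Let `y` be one, with state part `w`, and let `u` be the block of
`𝕄^S_s y` at position `m`, where `s` is the part of `α` to the right of `0`. Following `y` through
the factors of `𝕄^S_α` shows that the block `y_j` of `y` at position `m - j` is `λ ^ i_j u` if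
`j = m - 1` or `α` has an inversion at `j`, and otherwise satisfies
`λ ^ (c_j + 1) y_j = -(A_0 + ⋯ + λ ^ j A_j) u - C w`, where `i_j` and `c_j` count the inversions and
the consecutions of `α` below `j`. What remains of the pencil equation says that `(u, w)` is a null
vector of the system matrix; conversely, if it is one, then
`-(A_0 + ⋯ + λ ^ j A_j) u - C w = λ ^ (j + 1) (A_{j+1} + ⋯ + λ ^ (m-j-1) A_m) u`, so the formulas
define a polynomial vector `y`. As `λ E w = B u + A w` with `E` nonsingular, `w` never has larger
degree than `u`, and the degree of `y` exceeds that of `(u, w)` by exactly `i_{m-1} = i(α)`: the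
degree is attained in the block `λ ^ i(α) u`. A bijection of null spaces that lowers all degrees by
the same amount maps minimal bases to minimal bases.

In terms of `x = Q⁻¹ y`, the block `u` is obtained by applying the factors of index
`(s, σ₂)` with `σ = (l, 0, s)`. Reading off block position `m` of such a product moves one position
up at the next occurrence of `1`, then of `2`, and so on, and the successor infix property keeps the
position that is read untouched in between. Hence `u` is the block of `x` at position
`m - c₀(σ, σ₂)`. The left case follows by transposition, which reverses all tuples.
-/

namespace GFPR

open scoped Matrix

/-! ### Degree shifts of null spaces -/

section DegreeShift

variable {κ κ' κ'' : Type*}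

/-- The largest degree of the entries of a vector polynomial. -/
noncomputable def vecDegree [Fintype κ] (v : κ → ℂ[X]) : ℕ :=
  Finset.univ.sup fun k => (v k).natDegree

theorem vecDegree_le_iff [Fintype κ] {v : κ → ℂ[X]} {d : ℕ} :
    vecDegree v ≤ d ↔ ∀ k, (v k).natDegree ≤ d := by
  simp [vecDegree, Finset.sup_le_iff]

theorem natDegree_le_vecDegree [Fintype κ] (v : κ → ℂ[X]) (k : κ) :
    (v k).natDegree ≤ vecDegree v :=
  vecDegree_le_iff.1 le_rfl k

/-- A vector polynomial, viewed as a rational vector. -/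
noncomputable def ratVec (v : κ → ℂ[X]) : κ → RatFunc ℂ :=
  fun k => algebraMap ℂ[X] (RatFunc ℂ) (v k)

theorem ratVec_injective : Function.Injective (ratVec (κ := κ)) := fun _ _ h =>
  funext fun k => IsFractionRing.injective ℂ[X] (RatFunc ℂ) (congrFun h k)

theorem ratVec_zero : ratVec (0 : κ → ℂ[X]) = 0 :=
  funext fun _ => map_zero _

theorem ratVec_eq_zero {v : κ → ℂ[X]} : ratVec v = 0 ↔ v = 0 := by
  rw [← ratVec_zero, ratVec_injective.eq_iff]

theorem toRat_mulVec {ι : Type*} [Fintype κ] (M : Matrix ι κ ℂ[X]) (v : κ → ℂ[X]) :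
    toRat M *ᵥ ratVec v = ratVec (M *ᵥ v) := by
  funext i
  simp [toRat, ratVec, Matrix.mulVec, dotProduct]

theorem exists_smul_eq_ratVec [Finite κ] (v : κ → RatFunc ℂ) :
    ∃ q : RatFunc ℂ, q ≠ 0 ∧ ∃ w : κ → ℂ[X], q • v = ratVec w := by
  obtain ⟨b, hb⟩ := IsLocalization.exist_integer_multiples_of_finite (nonZeroDivisors ℂ[X]) v
  choose w hw using hb
  refine ⟨algebraMap ℂ[X] (RatFunc ℂ) b,
    IsLocalization.to_map_ne_zero_of_mem_nonZeroDivisors _ le_rfl b.2, w, funext fun k => ?_⟩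
  rw [ratVec, hw, Pi.smul_apply, algebraMap_smul]

theorem ratVec_mem_rightNull {ι : Type*} [Fintype ι] [Fintype κ] {M : Matrix ι κ ℂ[X]}
    {v : κ → ℂ[X]} : ratVec v ∈ rightNull (toRat M) ↔ M *ᵥ v = 0 := by
  rw [rightNull, LinearMap.mem_ker, Matrix.mulVecLin_apply, toRat_mulVec, ratVec_eq_zero]

variable {p q : ℕ} {N : Submodule (RatFunc ℂ) (κ → RatFunc ℂ)} {Z : Matrix κ (Fin p) ℂ[X]}
  {W : Matrix κ (Fin q) ℂ[X]}

theorem IsPolynomialBasis.ratVec_col_mem (hZ : IsPolynomialBasis N Z) (j : Fin p) :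
    ratVec (Z.col j) ∈ N :=
  hZ.2 ▸ Submodule.subset_span ⟨j, rfl⟩

theorem IsPolynomialBasis.col_ne_zero (hZ : IsPolynomialBasis N Z) (j : Fin p) : Z.col j ≠ 0 :=
  fun h0 => hZ.1.ne_zero j (ratVec_eq_zero.2 h0)

theorem IsPolynomialBasis.card_eq (hZ : IsPolynomialBasis N Z) (hW : IsPolynomialBasis N W) :
    p = q := by
  have hp := finrank_span_eq_card hZ.1
  have hq := finrank_span_eq_card hW.1
  rwa [hZ.2, ← hW.2, hq, Fintype.card_fin, Fintype.card_fin, eq_comm] at hp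

theorem toRat_mul_col [Fintype κ] (D : Matrix κ' κ ℂ[X]) (Z : Matrix κ (Fin p) ℂ[X]) :
    (fun j => (toRat (D * Z)).col j) = (toRat D).mulVecLin ∘ fun j => (toRat Z).col j :=
  funext fun j => (toRat_mulVec D (Z.col j)).symm

/-- Multiplication by `D` maps the vector polynomials of `N` bijectively onto those of `N'` and
lowers the degree of each of them, `0` excepted, by exactly `d`. -/
structure IsDegreeShift [Fintype κ] [Fintype κ'] (D : Matrix κ' κ ℂ[X]) (d : ℕ)
    (N : Submodule (RatFunc ℂ) (κ → RatFunc ℂ)) (N' : Submodule (RatFunc ℂ) (κ' → RatFunc ℂ)) :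
    Prop where
  map_mem : ∀ x, ratVec x ∈ N → ratVec (D *ᵥ x) ∈ N'
  exists_mulVec_eq : ∀ v, ratVec v ∈ N' → ∃ x, ratVec x ∈ N ∧ D *ᵥ x = v
  eq_zero : ∀ x, ratVec x ∈ N → D *ᵥ x = 0 → x = 0
  vecDegree_eq : ∀ x, ratVec x ∈ N → x ≠ 0 → vecDegree x = vecDegree (D *ᵥ x) + d

variable [Fintype κ] [Fintype κ'] [Fintype κ''] {D : Matrix κ' κ ℂ[X]} {D' : Matrix κ'' κ' ℂ[X]}
  {d d' : ℕ} {N' : Submodule (RatFunc ℂ) (κ' → RatFunc ℂ)}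
  {N'' : Submodule (RatFunc ℂ) (κ'' → RatFunc ℂ)}

theorem IsDegreeShift.comp (h' : IsDegreeShift D' d' N' N'') (h : IsDegreeShift D d N N') :
    IsDegreeShift (D' * D) (d' + d) N N'' where
  map_mem x hx := by
    rw [← Matrix.mulVec_mulVec]
    exact h'.map_mem _ (h.map_mem x hx)
  exists_mulVec_eq v hv := by
    obtain ⟨y, hy, rfl⟩ := h'.exists_mulVec_eq v hv
    obtain ⟨x, hx, rfl⟩ := h.exists_mulVec_eq y hy
    exact ⟨x, hx, (Matrix.mulVec_mulVec ..).symm⟩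
  eq_zero x hx h0 := by
    rw [← Matrix.mulVec_mulVec] at h0
    exact h.eq_zero x hx (h'.eq_zero _ (h.map_mem x hx) h0)
  vecDegree_eq x hx hne := by
    rw [← Matrix.mulVec_mulVec, h.vecDegree_eq x hx hne,
      h'.vecDegree_eq _ (h.map_mem x hx) (mt (h.eq_zero x hx) hne), add_assoc]

theorem IsDegreeShift.map_eq (h : IsDegreeShift D d N N') :
    N.map (toRat D).mulVecLin = N' := by
  apply le_antisymm
  · rintro _ ⟨x, hx, rfl⟩
    obtain ⟨q, hq, w, hw⟩ := exists_smul_eq_ratVec x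
    rw [← N'.smul_mem_iff hq, ← map_smul, hw, Matrix.mulVecLin_apply, toRat_mulVec]
    exact h.map_mem w (hw ▸ N.smul_mem q hx)
  · intro v hv
    obtain ⟨q, hq, w, hw⟩ := exists_smul_eq_ratVec v
    obtain ⟨x, hx, rfl⟩ := h.exists_mulVec_eq w (hw ▸ N'.smul_mem q hv)
    rw [← Submodule.smul_mem_iff _ hq, hw, ← toRat_mulVec]
    exact ⟨_, hx, rfl⟩

theorem IsDegreeShift.disjoint_ker (h : IsDegreeShift D d N N') :
    Disjoint N (LinearMap.ker (toRat D).mulVecLin) := by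
  rw [Submodule.disjoint_def]
  intro x hx h0
  obtain ⟨q, hq, w, hw⟩ := exists_smul_eq_ratVec x
  have hDw : D *ᵥ w = 0 := by
    rw [← ratVec_eq_zero, ← toRat_mulVec, ← hw, Matrix.mulVec_smul]
    exact (congrArg (q • ·) h0).trans (smul_zero q)
  rw [h.eq_zero w (hw ▸ N.smul_mem q hx) hDw, ratVec_zero] at hw
  exact (smul_eq_zero.1 hw).resolve_left hq

theorem IsDegreeShift.isPolynomialBasis_mul_iff (h : IsDegreeShift D d N N')
    (hZ : ∀ j, ratVec (Z.col j) ∈ N) :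
    IsPolynomialBasis N' (D * Z) ↔ IsPolynomialBasis N Z := by
  have hspan : Submodule.span (RatFunc ℂ) (Set.range fun j => (toRat Z).col j) ≤ N :=
    Submodule.span_le.2 (Set.range_subset_iff.2 hZ)
  have hinj : Set.InjOn (toRat D).mulVecLin N :=
    LinearMap.injOn_of_disjoint_ker le_rfl h.disjoint_ker
  rw [IsPolynomialBasis, IsPolynomialBasis, toRat_mul_col, Set.range_comp, ← Submodule.map_span,
    LinearMap.linearIndependent_iff_of_disjoint _ (h.disjoint_ker.mono_left hspan), ← h.map_eq]
  refine and_congr_right fun _ => ⟨fun heq => hspan.antisymm fun y hy => ?_, congrArg _⟩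
  obtain ⟨z, hz, hzy⟩ := heq.ge (Submodule.mem_map_of_mem hy)
  exact hinj (hspan hz) hy hzy ▸ hz

theorem IsDegreeShift.colDegree_eq (h : IsDegreeShift D d N N') (hZ : IsPolynomialBasis N Z)
    (j : Fin p) : colDegree Z j = colDegree (D * Z) j + d :=
  h.vecDegree_eq _ (hZ.ratVec_col_mem j) (hZ.col_ne_zero j)

theorem IsDegreeShift.order_eq (h : IsDegreeShift D d N N') (hZ : IsPolynomialBasis N Z) :
    order Z = order (D * Z) + p * d := by
  simp [order, h.colDegree_eq hZ, Finset.sum_add_distrib]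

theorem IsDegreeShift.isMinimalBasis_mul (h : IsDegreeShift D d N N') (hZ : IsMinimalBasis N Z) :
    IsMinimalBasis N' (D * Z) where
  basis := (h.isPolynomialBasis_mul_iff hZ.basis.ratVec_col_mem).2 hZ.basis
  sorted i j hij := by
    have hle := hZ.sorted hij
    rw [h.colDegree_eq hZ.basis, h.colDegree_eq hZ.basis] at hle
    exact Nat.add_le_add_iff_right.1 hle
  order_le q W hW := by
    choose x hxN hxW using fun j => h.exists_mulVec_eq (W.col j) (hW.ratVec_col_mem j)
    set V : Matrix κ (Fin q) ℂ[X] := (Matrix.of x)ᵀ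
    have hDV : D * V = W := Matrix.ext fun i j => congrFun (hxW j) i
    have hV : IsPolynomialBasis N V := (h.isPolynomialBasis_mul_iff hxN).1 (hDV ▸ hW)
    have hle := hZ.order_le q V hV
    obtain rfl := hZ.basis.card_eq hV
    rw [h.order_eq hZ.basis, h.order_eq hV, hDV] at hle
    exact Nat.add_le_add_iff_right.1 hle

theorem IsDegreeShift.exists_isMinimalBasis (h : IsDegreeShift D d N N') {ε : Fin p → ℤ} :
    (∃ Z, IsMinimalBasis N Z ∧ ∀ j, (colDegree Z j : ℤ) = ε j) →
      ∃ Z', IsMinimalBasis N' Z' ∧ ∀ j, (colDegree Z' j : ℤ) = ε j - d := by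
  rintro ⟨Z, hZ, hε⟩
  refine ⟨D * Z, h.isMinimalBasis_mul hZ, fun j => ?_⟩
  rw [← hε j, h.colDegree_eq hZ.1 j]
  push_cast
  ring

end DegreeShift

section Const

variable {ι κ μ : Type*}

theorem const_mul [Fintype κ] (M : Matrix ι κ ℂ) (N : Matrix κ μ ℂ) :
    const (M * N) = const M * const N := Matrix.map_mul

@[simp] theorem const_one [DecidableEq ι] : const (1 : Matrix ι ι ℂ) = 1 :=
  Matrix.map_one _ Polynomial.C_0 Polynomial.C_1

@[simp] theorem const_zero : const (0 : Matrix ι κ ℂ) = 0 := Matrix.map_zero _ Polynomial.C_0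

@[simp] theorem const_neg (M : Matrix ι κ ℂ) : const (-M) = -const M := by
  ext i j; simp [const]

theorem const_fromBlocks {ι' κ' : Type*} (A : Matrix ι κ ℂ) (B : Matrix ι κ' ℂ)
    (C : Matrix ι' κ ℂ) (D : Matrix ι' κ' ℂ) :
    const (Matrix.fromBlocks A B C D) = Matrix.fromBlocks (const A) (const B) (const C) (const D) :=
  Matrix.fromBlocks_map _ _ _ _ _

theorem det_const [Fintype ι] [DecidableEq ι] (M : Matrix ι ι ℂ) :
    (const M).det = Polynomial.C M.det :=
  (RingHom.map_det Polynomial.C M).symm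

theorem vecDegree_const_mulVec_le [Fintype ι] [Fintype κ] (M : Matrix ι κ ℂ) (x : κ → ℂ[X]) :
    vecDegree (const M *ᵥ x) ≤ vecDegree x :=
  vecDegree_le_iff.2 fun _ => Polynomial.natDegree_sum_le_of_forall_le _ _ fun k _ =>
    (Polynomial.natDegree_C_mul_le _ _).trans (natDegree_le_vecDegree x k)

variable [Fintype ι] [DecidableEq ι] {M : Matrix ι ι ℂ}

theorem det_ne_zero_of_const_mulVec (h : ∀ x : ι → ℂ[X], const M *ᵥ x = 0 → x = 0) :
    M.det ≠ 0 := by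
  intro h0
  obtain ⟨v, hv, hv0⟩ := Matrix.exists_mulVec_eq_zero_iff (M := const M).2
    (by rw [det_const, h0, Polynomial.C_0])
  exact hv (h v hv0)

theorem const_nonsing_inv_mulVec (h : M.det ≠ 0) (x : ι → ℂ[X]) :
    const M⁻¹ *ᵥ const M *ᵥ x = x := by
  rw [Matrix.mulVec_mulVec, ← const_mul, Matrix.nonsing_inv_mul _ (isUnit_iff_ne_zero.2 h),
    const_one, Matrix.one_mulVec]

theorem const_mulVec_nonsing_inv (h : M.det ≠ 0) (x : ι → ℂ[X]) :
    const M *ᵥ const M⁻¹ *ᵥ x = x := by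
  rw [Matrix.mulVec_mulVec, ← const_mul, Matrix.mul_nonsing_inv _ (isUnit_iff_ne_zero.2 h),
    const_one, Matrix.one_mulVec]

theorem eq_zero_of_const_mulVec_eq_zero (h : M.det ≠ 0) {x : ι → ℂ[X]} (hx : const M *ᵥ x = 0) :
    x = 0 := by
  rw [← const_nonsing_inv_mulVec h x, hx, Matrix.mulVec_zero]

theorem vecDegree_const_mulVec (h : M.det ≠ 0) (x : ι → ℂ[X]) :
    vecDegree (const M *ᵥ x) = vecDegree x := by
  refine (vecDegree_const_mulVec_le M x).antisymm ?_
  conv_lhs => rw [← const_nonsing_inv_mulVec h x]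
  exact vecDegree_const_mulVec_le M⁻¹ _

theorem isDegreeShift_const {P Q : Matrix ι ι ℂ} (hP : P.det ≠ 0) (hQ : Q.det ≠ 0)
    (L : Matrix ι ι ℂ[X]) :
    IsDegreeShift (const Q) 0 (rightNull (toRat (const P * L * const Q)))
      (rightNull (toRat L)) := by
  have hnull (x : ι → ℂ[X]) : ratVec x ∈ rightNull (toRat (const P * L * const Q)) ↔
      ratVec (const Q *ᵥ x) ∈ rightNull (toRat L) := by
    rw [ratVec_mem_rightNull, ratVec_mem_rightNull, ← Matrix.mulVec_mulVec, ← Matrix.mulVec_mulVec]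
    exact ⟨eq_zero_of_const_mulVec_eq_zero hP, fun h => by rw [h, Matrix.mulVec_zero]⟩
  refine ⟨fun x => (hnull x).1, fun v hv => ⟨const Q⁻¹ *ᵥ v, ?_⟩, fun x _ => ?_, fun x _ _ => ?_⟩
  · rw [hnull, const_mulVec_nonsing_inv hQ]
    exact ⟨hv, rfl⟩
  · exact eq_zero_of_const_mulVec_eq_zero hQ
  · exact (vecDegree_const_mulVec hQ x).symm

end Const

/-! ### Elementary and Fiedler matrices acting on blocks -/

section Blocks

variable {m n r : ℕ}

/-- The vector polynomials with `m` blocks of size `n` and a state part of size `r`, on which the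
pencils act. -/
abbrev BlockVec (m n r : ℕ) : Type := (Fin m × Fin n) ⊕ Fin r → ℂ[X]

/-- The block of `x` in block row `m - j` (counted from 1), called register `j`; it is `0` for
`j ≥ m`. The matrix `M_i` acts on the registers `|i|` and `|i| - 1`. -/
noncomputable def reg (x : BlockVec m n r) (j : ℕ) : Fin n → ℂ[X] :=
  fun k => if h : j < m then x (Sum.inl (⟨m - 1 - j, by omega⟩, k)) else 0

/-- The last `r` entries of `x`. -/
def statePart (x : BlockVec m n r) : Fin r → ℂ[X] := x ∘ Sum.inr

/-- The vector with given registers and state part. -/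
def ofReg (y : ℕ → Fin n → ℂ[X]) (w : Fin r → ℂ[X]) : BlockVec m n r :=
  Sum.elim (fun a => y (m - 1 - a.1) a.2) w

theorem reg_of_le (x : BlockVec m n r) {j : ℕ} (h : m ≤ j) : reg x j = 0 := by
  funext k; simp [reg, Nat.not_lt.2 h]

theorem reg_apply (x : BlockVec m n r) {j : ℕ} (h : j < m) (k : Fin n) :
    reg x j k = x (Sum.inl (⟨m - 1 - j, by omega⟩, k)) := by
  simp [reg, h]

theorem apply_inl (x : BlockVec m n r) (a : Fin m) (k : Fin n) :
    x (Sum.inl (a, k)) = reg x (m - 1 - a) k := by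
  rw [reg_apply x (by omega)]
  congr 3
  ext
  dsimp only; omega

theorem ext_reg {x y : BlockVec m n r} (h : ∀ j < m, reg x j = reg y j)
    (hs : statePart x = statePart y) : x = y := by
  funext i
  rcases i with ⟨a, k⟩ | k
  · rw [apply_inl x, apply_inl y, h _ (by omega)]
  · exact congrFun hs k

@[simp] theorem reg_zero (j : ℕ) : reg (0 : BlockVec m n r) j = 0 := by
  funext k; simp [reg]

theorem reg_smul (c : ℂ[X]) (x : BlockVec m n r) (j : ℕ) : reg (c • x) j = c • reg x j := by
  funext k; simp only [reg, Pi.smul_apply]; split_ifs <;> simp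

theorem reg_ofReg (y : ℕ → Fin n → ℂ[X]) (w : Fin r → ℂ[X]) {j : ℕ} (h : j < m) :
    reg (ofReg (m := m) y w) j = y j := by
  funext k
  simp [reg_apply _ h, ofReg, Nat.sub_sub_self (Nat.le_sub_one_of_lt h)]

theorem statePart_ofReg (y : ℕ → Fin n → ℂ[X]) (w : Fin r → ℂ[X]) :
    statePart (ofReg (m := m) y w) = w := rfl

theorem reg_fromBlocks_mulVec {Bl : Matrix (Fin m) (Fin m) (Matrix (Fin n) (Fin n) ℂ)}
    {B : Matrix (Fin m × Fin n) (Fin r) ℂ} {C : Matrix (Fin r) (Fin m × Fin n) ℂ}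
    {D : Matrix (Fin r) (Fin r) ℂ} (x : BlockVec m n r) {j : ℕ} (h : j < m) :
    reg (const (Matrix.fromBlocks (Matrix.comp _ _ _ _ ℂ Bl) B C D) *ᵥ x) j =
      ∑ b, const (Bl ⟨m - 1 - j, by omega⟩ b) *ᵥ reg x (m - 1 - b) +
        fun k => (const B *ᵥ statePart x) (⟨m - 1 - j, by omega⟩, k) := by
  funext k
  rw [reg_apply _ h, const_fromBlocks, Matrix.fromBlocks_mulVec, Sum.elim_inl, Pi.add_apply,
    Pi.add_apply, Finset.sum_apply]
  simp only [Matrix.mulVec, dotProduct, Fintype.sum_prod_type, const, Matrix.map_apply,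
    Matrix.comp_apply, Function.comp, apply_inl, statePart]

theorem statePart_fromBlocks_mulVec {A : Matrix (Fin m × Fin n) (Fin m × Fin n) ℂ}
    {B : Matrix (Fin m × Fin n) (Fin r) ℂ} {C : Matrix (Fin r) (Fin m × Fin n) ℂ}
    {D : Matrix (Fin r) (Fin r) ℂ} (x : BlockVec m n r) :
    statePart (const (Matrix.fromBlocks A B C D) *ᵥ x) =
      const C *ᵥ (x ∘ Sum.inl) + const D *ᵥ statePart x := by
  rw [const_fromBlocks, Matrix.fromBlocks_mulVec]
  rfl

theorem sum_row_single {Bl : Matrix (Fin m) (Fin m) (Matrix (Fin n) (Fin n) ℂ)} {a b₁ : Fin m}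
    {X₁ : Matrix (Fin n) (Fin n) ℂ} (h : ∀ b, Bl a b = if b = b₁ then X₁ else 0)
    (x : BlockVec m n r) :
    ∑ b, const (Bl a b) *ᵥ reg x (m - 1 - b) = const X₁ *ᵥ reg x (m - 1 - b₁) := by
  rw [Finset.sum_eq_single b₁ (fun b _ hb => by simp [h, hb]) (by simp), h, if_pos rfl]

theorem sum_row_pair {Bl : Matrix (Fin m) (Fin m) (Matrix (Fin n) (Fin n) ℂ)} {a b₁ b₂ : Fin m}
    {X₁ : Matrix (Fin n) (Fin n) ℂ} (h12 : b₁ ≠ b₂)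
    (h : ∀ b, Bl a b = if b = b₁ then X₁ else if b = b₂ then 1 else 0) (x : BlockVec m n r) :
    ∑ b, const (Bl a b) *ᵥ reg x (m - 1 - b) =
      const X₁ *ᵥ reg x (m - 1 - b₁) + reg x (m - 1 - b₂) := by
  rw [Finset.sum_eq_add b₁ b₂ h12 (fun b _ hb => by simp [h, hb.1, hb.2]) (by simp) (by simp), h,
    h, if_pos rfl, if_neg h12.symm, if_pos rfl, const_one, Matrix.one_mulVec]

section ElementaryMatrices

variable {i : ℤ} {Y : Matrix (Fin n) (Fin n) ℂ}

theorem elemBlocks_row_other {a : Fin m} (h1 : (a : ℕ) + 1 + i.natAbs ≠ m)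
    (h2 : (a : ℕ) + i.natAbs ≠ m) (b : Fin m) :
    elemBlocks m i Y a b = if b = a then 1 else 0 := by
  unfold elemBlocks
  split_ifs with hi hi' <;> simp_all [eq_comm]

theorem elemBlocks_zero_row {a : Fin m} (h : (a : ℕ) + 1 = m) (b : Fin m) :
    elemBlocks m 0 Y a b = if b = a then Y else 0 := by
  simp [elemBlocks, Matrix.diagonal_apply, eq_comm, h]

theorem elemBlocks_neg_row {a : Fin m} (h : (a : ℕ) = 0) (b : Fin m) :
    elemBlocks m (-m) Y a b = if b = a then Y else 0 := by
  have hm : m ≠ 0 := by omega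
  simp [elemBlocks, Matrix.diagonal_apply, eq_comm, h, hm]

theorem elemBlocks_row_left {a a' : Fin m} (h1 : 0 < i.natAbs) (h2 : i.natAbs < m)
    (h : (a : ℕ) + 1 + i.natAbs = m) (h' : (a' : ℕ) = a + 1) (b : Fin m) :
    elemBlocks m i Y a b = if b = a then (if 0 < i then Y else 0) else if b = a' then 1 else 0 := by
  have hi : i ≠ 0 := by omega
  have hi' : i ≠ -(m : ℤ) := by omega
  simp only [elemBlocks, hi, hi', if_false, Matrix.of_apply, Fin.ext_iff]
  grind

theorem elemBlocks_row_right {a a' : Fin m} (h1 : 0 < i.natAbs) (h2 : i.natAbs < m)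
    (h : (a : ℕ) + i.natAbs = m) (h' : (a : ℕ) = a' + 1) (b : Fin m) :
    elemBlocks m i Y a b = if b = a then (if 0 < i then 0 else Y) else if b = a' then 1 else 0 := by
  have hi : i ≠ 0 := by omega
  have hi' : i ≠ -(m : ℤ) := by omega
  simp only [elemBlocks, hi, hi', if_false, Matrix.of_apply, Fin.ext_iff]
  grind

theorem reg_bigElem (x : BlockVec m n r) {j : ℕ} (h : j < m) :
    reg (const (bigElem m r i Y) *ᵥ x) j =
      ∑ b, const (elemBlocks m i Y ⟨m - 1 - j, by omega⟩ b) *ᵥ reg x (m - 1 - b) := by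
  rw [bigElem, elem, reg_fromBlocks_mulVec x h, const_zero, Matrix.zero_mulVec]
  exact add_zero _

theorem statePart_bigElem (x : BlockVec m n r) :
    statePart (const (bigElem m r i Y) *ᵥ x) = statePart x := by
  rw [bigElem, statePart_fromBlocks_mulVec, const_zero, const_one, Matrix.zero_mulVec,
    Matrix.one_mulVec, zero_add]

theorem reg_bigElem_other (x : BlockVec m n r) {j : ℕ} (h1 : j ≠ i.natAbs)
    (h2 : j + 1 ≠ i.natAbs) : reg (const (bigElem m r i Y) *ᵥ x) j = reg x j := by
  rcases lt_or_ge j m with h | h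
  · rw [reg_bigElem x h, sum_row_single
      (elemBlocks_row_other (by dsimp only; omega) (by dsimp only; omega)),
      const_one, Matrix.one_mulVec, Nat.sub_sub_self (Nat.le_sub_one_of_lt h)]
  · rw [reg_of_le _ h, reg_of_le _ h]

theorem reg_bigElem_zero (x : BlockVec m n r) :
    reg (const (bigElem m r 0 Y) *ᵥ x) 0 = const Y *ᵥ reg x 0 := by
  rcases m.eq_zero_or_pos with rfl | h
  · rw [reg_of_le _ le_rfl, reg_of_le _ le_rfl, Matrix.mulVec_zero]
  · rw [reg_bigElem x h, sum_row_single (elemBlocks_zero_row (by dsimp only; omega)),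
      Nat.sub_sub_self (Nat.zero_le _)]

theorem reg_bigElem_neg_last (x : BlockVec m n r) :
    reg (const (bigElem m r (-m) Y) *ᵥ x) (m - 1) = const Y *ᵥ reg x (m - 1) := by
  rcases m.eq_zero_or_pos with rfl | h
  · rw [reg_of_le _ (Nat.zero_le _), reg_of_le _ (Nat.zero_le _), Matrix.mulVec_zero]
  · rw [reg_bigElem x (Nat.sub_one_lt_of_lt h), sum_row_single (elemBlocks_neg_row (by simp)),
      Nat.sub_sub_self le_rfl]

theorem reg_bigElem_natAbs (x : BlockVec m n r) (h1 : 0 < i.natAbs) (h2 : i.natAbs < m) :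
    reg (const (bigElem m r i Y) *ᵥ x) i.natAbs =
      const (if 0 < i then Y else 0) *ᵥ reg x i.natAbs + reg x (i.natAbs - 1) := by
  rw [reg_bigElem x h2,
    sum_row_pair (b₂ := ⟨m - i.natAbs, by omega⟩) (Fin.ne_of_val_ne (by dsimp only; omega))
      (elemBlocks_row_left h1 h2 (by dsimp only; omega) (by dsimp only; omega)),
    show m - 1 - (m - 1 - i.natAbs) = i.natAbs by omega,
    show m - 1 - (m - i.natAbs) = i.natAbs - 1 by omega]

theorem reg_bigElem_natAbs_sub_one (x : BlockVec m n r) (h1 : 0 < i.natAbs) (h2 : i.natAbs < m) :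
    reg (const (bigElem m r i Y) *ᵥ x) (i.natAbs - 1) =
      const (if 0 < i then 0 else Y) *ᵥ reg x (i.natAbs - 1) + reg x i.natAbs := by
  rw [reg_bigElem x (by omega),
    sum_row_pair (b₂ := ⟨m - 1 - i.natAbs, by omega⟩) (Fin.ne_of_val_ne (by dsimp only; omega))
      (elemBlocks_row_right h1 h2 (by dsimp only; omega) (by dsimp only; omega)),
    show m - 1 - (m - 1 - (i.natAbs - 1)) = i.natAbs - 1 by omega,
    show m - 1 - (m - 1 - i.natAbs) = i.natAbs by omega]

theorem eq_zero_of_bigElem_mulVec {x : BlockVec m n r} (hx : const (bigElem m r i Y) *ᵥ x = 0)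
    (h0 : reg x i.natAbs = 0) (h1 : reg x (i.natAbs - 1) = 0) : x = 0 := by
  refine ext_reg (fun j _ => ?_) ?_
  · rcases eq_or_ne j i.natAbs with rfl | hj
    · rw [h0, reg_zero]
    rcases eq_or_ne (j + 1) i.natAbs with hj' | hj'
    · rw [show j = i.natAbs - 1 by omega, h1, reg_zero]
    · rw [← reg_bigElem_other x hj hj', hx]
  · rw [← statePart_bigElem (i := i) (Y := Y), hx]

theorem det_bigElem_ne_zero (hi : i.natAbs < m ∨ i = -m) (hY : i = 0 ∨ i = -m → Y.det ≠ 0) :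
    (bigElem m r i Y).det ≠ 0 := by
  refine det_ne_zero_of_const_mulVec fun x hx => ?_
  by_cases him : i = -m
  · have hlast := reg_bigElem_neg_last (Y := Y) x
    rw [← him, hx, reg_zero] at hlast
    refine eq_zero_of_bigElem_mulVec hx (reg_of_le _ (by omega)) ?_
    rw [show i.natAbs - 1 = m - 1 by omega]
    exact eq_zero_of_const_mulVec_eq_zero (hY (Or.inr him)) hlast.symm
  rcases eq_or_ne i 0 with rfl | hi0
  · have hfirst := reg_bigElem_zero (Y := Y) x
    rw [hx, reg_zero] at hfirst
    have h0 := eq_zero_of_const_mulVec_eq_zero (hY (Or.inl rfl)) hfirst.symm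
    exact eq_zero_of_bigElem_mulVec hx h0 h0
  have hupper := reg_bigElem_natAbs (Y := Y) x (Int.natAbs_pos.2 hi0) (hi.resolve_right him)
  have hlower := reg_bigElem_natAbs_sub_one (Y := Y) x (Int.natAbs_pos.2 hi0)
    (hi.resolve_right him)
  rw [hx, reg_zero] at hupper hlower
  split_ifs at hupper hlower
  · rw [const_zero, Matrix.zero_mulVec, zero_add] at hlower
    rw [← hlower, Matrix.mulVec_zero, zero_add] at hupper
    exact eq_zero_of_bigElem_mulVec hx hlower.symm hupper.symm
  · rw [const_zero, Matrix.zero_mulVec, zero_add] at hupper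
    rw [← hupper, Matrix.mulVec_zero, zero_add] at hlower
    exact eq_zero_of_bigElem_mulVec hx hlower.symm hupper.symm

theorem det_bigElemProd_ne_zero {t : List ℤ} {X : List (Matrix (Fin n) (Fin n) ℂ)}
    (ht : ∀ i ∈ t, i.natAbs < m ∨ i = -m) (hX : IsNonsingularAssignment m t X) :
    (bigElemProd m r t X).det ≠ 0 := by
  rw [bigElemProd]
  induction t generalizing X with
  | nil => simp
  | cons i t ih =>
    rcases X with _ | ⟨Y, X⟩
    · simp
    · rw [List.forall_mem_cons] at ht
      have hX2 : (i = 0 ∨ i = -m → Y.det ≠ 0) ∧ _ := List.forall_mem_cons.1 hX.2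
      rw [List.zipWith_cons_cons, List.prod_cons, Matrix.det_mul]
      exact mul_ne_zero (det_bigElem_ne_zero ht.1 hX2.1)
        (ih ht.2 ⟨Nat.succ_injective hX.1, hX2.2⟩)

end ElementaryMatrices

end Blocks

namespace Realization

variable {m n r : ℕ} (R : Realization m n r)

theorem fiedlerS_pos {i : ℕ} (h : 0 < i) : R.fiedlerS i = bigElem m r i (-R.coeff i) := by
  have him : (i : ℤ) ≠ -(m : ℤ) := by omega
  simp [fiedlerS, fiedlerP, bigElem, him, h, h.ne']

theorem fiedlerS_neg {i : ℕ} (h : 0 < i) (h' : i < m) : R.fiedlerS (-i) = (R.fiedlerS i)⁻¹ := by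
  have him : (i : ℤ) ≠ -(m : ℤ) := by omega
  simp [fiedlerS, him, h, h'.ne, h.ne', (Int.natCast_nonneg i).not_gt]

theorem det_fiedlerS_pos {i : ℕ} (h : 0 < i) (h' : i < m) : (R.fiedlerS i).det ≠ 0 := by
  rw [R.fiedlerS_pos h]
  exact det_bigElem_ne_zero (Or.inl h') (by omega)

theorem fiedlerS_zero : R.fiedlerS 0 = Matrix.fromBlocks (elem m 0 (-R.coeff 0))
    (-blockCol m (m : ℤ) R.C) (-blockRow m (m : ℤ) R.B) (-R.A) := by
  simp [fiedlerS, fiedlerP]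

theorem fiedlerS_neg_last (h : 0 < m) : R.fiedlerS (-m) =
    Matrix.fromBlocks (elem m (-m) (R.coeff m)) 0 0 (-R.E) := by
  simp [fiedlerS, fiedlerP, h.ne']

variable (x : BlockVec m n r)

theorem reg_fiedlerS_other {i j : ℕ} (h1 : j ≠ i) (h2 : j + 1 ≠ i) :
    reg (const (R.fiedlerS i) *ᵥ x) j = reg x j := by
  rcases Nat.eq_zero_or_pos i with rfl | h
  · rcases lt_or_ge j m with h | h
    · have hj : ((m - 1 - j : ℕ) : ℤ) + 1 ≠ m := by omega
      have hC (k : Fin n) :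
          (const (-blockCol m m R.C) *ᵥ statePart x) (⟨m - 1 - j, by omega⟩, k) = 0 := by
        simp [Matrix.mulVec, dotProduct, const, blockCol, hj]
      rw [Nat.cast_zero, fiedlerS_zero, elem, reg_fromBlocks_mulVec x h,
        sum_row_single (elemBlocks_row_other (by dsimp only; omega) (by dsimp only; omega)),
        const_one, Matrix.one_mulVec, Nat.sub_sub_self (Nat.le_sub_one_of_lt h)]
      simp only [hC]
      exact add_zero _
    · rw [reg_of_le _ h, reg_of_le _ h]
  · rw [R.fiedlerS_pos h, reg_bigElem_other x (by simpa) (by simpa)]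

theorem reg_fiedlerS_self {i : ℕ} (h : 0 < i) (h' : i < m) :
    reg (const (R.fiedlerS i) *ᵥ x) i = reg x (i - 1) - const (R.coeff i) *ᵥ reg x i := by
  have hreg := reg_bigElem_natAbs (i := i) (Y := -R.coeff i) x (by simpa) (by simpa)
  rw [Int.natAbs_natCast, if_pos (by simpa)] at hreg
  rw [R.fiedlerS_pos h, hreg, const_neg, Matrix.neg_mulVec, neg_add_eq_sub]

theorem reg_fiedlerS_pred {i : ℕ} (h : 0 < i) (h' : i < m) :
    reg (const (R.fiedlerS i) *ᵥ x) (i - 1) = reg x i := by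
  have hreg := reg_bigElem_natAbs_sub_one (i := i) (Y := -R.coeff i) x (by simpa) (by simpa)
  rw [Int.natAbs_natCast, if_pos (by simpa)] at hreg
  rw [R.fiedlerS_pos h, hreg, const_zero, Matrix.zero_mulVec, zero_add]

theorem statePart_fiedlerS_pos {i : ℕ} (h : 0 < i) :
    statePart (const (R.fiedlerS i) *ᵥ x) = statePart x := by
  rw [R.fiedlerS_pos h, statePart_bigElem]

theorem reg_fiedlerS_zero (h : 0 < m) :
    reg (const (R.fiedlerS 0) *ᵥ x) 0 =
      -(const (R.coeff 0) *ᵥ reg x 0) - const R.C *ᵥ statePart x := by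
  have hm : ((m - 1 : ℕ) : ℤ) + 1 = m := by omega
  have hC : (fun k => (const (-blockCol m m R.C) *ᵥ statePart x) (⟨m - 1 - 0, by omega⟩, k)) =
      -(const R.C *ᵥ statePart x) := by
    funext k
    simp [Matrix.mulVec, dotProduct, const, blockCol, hm]
  rw [fiedlerS_zero, elem, reg_fromBlocks_mulVec x h, hC,
    sum_row_single (elemBlocks_zero_row (by dsimp only; omega)), const_neg, Matrix.neg_mulVec,
    Nat.sub_sub_self (Nat.zero_le _), sub_eq_add_neg]

theorem statePart_fiedlerS_zero (h : 0 < m) :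
    statePart (const (R.fiedlerS 0) *ᵥ x) =
      -(const R.B *ᵥ reg x 0) - const R.A *ᵥ statePart x := by
  have hB : const (blockRow m m R.B) *ᵥ (x ∘ Sum.inl) = const R.B *ᵥ reg x 0 := by
    funext k
    simp only [Matrix.mulVec, dotProduct, Fintype.sum_prod_type]
    rw [Finset.sum_eq_single ⟨m - 1, by omega⟩ _ (by simp)]
    · have hm : ((m - 1 : ℕ) : ℤ) + 1 = m := by omega
      simp [const, blockRow, apply_inl, hm]
    · intro b _ hb
      have hbm : (b : ℤ) + 1 ≠ m := fun hbm => hb (Fin.ext (by dsimp only; omega))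
      simp [const, blockRow, hbm]
  rw [fiedlerS_zero, statePart_fromBlocks_mulVec, const_neg, const_neg, Matrix.neg_mulVec,
    Matrix.neg_mulVec, hB, ← sub_eq_add_neg]

theorem reg_fiedlerS_neg_other {j : ℕ} (h : j + 1 < m) :
    reg (const (R.fiedlerS (-m)) *ᵥ x) j = reg x j := by
  rw [R.fiedlerS_neg_last (by omega), elem, reg_fromBlocks_mulVec x (by omega),
    sum_row_single (elemBlocks_row_other (by simp) (by dsimp only; omega)), const_one,
    Matrix.one_mulVec, Nat.sub_sub_self (by omega), const_zero, Matrix.zero_mulVec]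
  exact add_zero _

theorem reg_fiedlerS_neg_last (h : 0 < m) :
    reg (const (R.fiedlerS (-m)) *ᵥ x) (m - 1) = const (R.coeff m) *ᵥ reg x (m - 1) := by
  rw [R.fiedlerS_neg_last h, elem, reg_fromBlocks_mulVec x (Nat.sub_one_lt_of_lt h),
    sum_row_single (elemBlocks_neg_row (by simp)), Nat.sub_sub_self le_rfl, const_zero,
    Matrix.zero_mulVec]
  exact add_zero _

theorem statePart_fiedlerS_neg_last (h : 0 < m) :
    statePart (const (R.fiedlerS (-m)) *ᵥ x) = -(const R.E *ᵥ statePart x) := by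
  rw [R.fiedlerS_neg_last h, statePart_fromBlocks_mulVec, const_zero, Matrix.zero_mulVec,
    zero_add, const_neg, Matrix.neg_mulVec]

theorem fiedlerSProd_append (s t : List ℤ) :
    R.fiedlerSProd (s ++ t) = R.fiedlerSProd s * R.fiedlerSProd t := by
  rw [fiedlerSProd, List.map_append, List.prod_append, fiedlerSProd, fiedlerSProd]

end Realization

/-! ### The successor infix property -/

section IndexTuples

theorem sip_iff {t : List ℤ} : SIP t ↔ ∀ (a b : ℕ) (i : ℤ), a < b → t[a]? = some i →
    t[b]? = some i → ∃ c, a < c ∧ c < b ∧ t[c]? = some (i + 1) := by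
  constructor
  · intro h a b i hab ha hb
    obtain ⟨ha', rfl⟩ := List.getElem?_eq_some_iff.1 ha
    obtain ⟨hb', hb⟩ := List.getElem?_eq_some_iff.1 hb
    obtain ⟨c, hac, hcb, hc⟩ := h ⟨a, ha'⟩ ⟨b, hb'⟩ hab hb.symm
    exact ⟨c, hac, hcb, List.getElem?_eq_some_iff.2 ⟨c.2, hc⟩⟩
  · intro h a b hab heq
    obtain ⟨c, hac, hcb, hc⟩ := h a b _ hab (List.getElem?_eq_getElem a.2)
      ((List.getElem?_eq_getElem b.2).trans (congrArg some heq.symm))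
    obtain ⟨hc', hc⟩ := List.getElem?_eq_some_iff.1 hc
    exact ⟨⟨c, hc'⟩, hac, hcb, hc⟩

theorem SIP.of_append_right {l t : List ℤ} (h : SIP (l ++ t)) : SIP t := by
  have hget (c : ℕ) : (l ++ t)[l.length + c]? = t[c]? := by
    rw [List.getElem?_append_right (Nat.le_add_right _ _), Nat.add_sub_cancel_left]
  rw [sip_iff] at h ⊢
  intro a b i hab ha hb
  obtain ⟨c, hac, hcb, hc⟩ := h (l.length + a) (l.length + b) i (by omega)
    ((hget a).trans ha) ((hget b).trans hb)
  obtain ⟨c, rfl⟩ := Nat.exists_eq_add_of_le (show l.length ≤ c by omega)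
  exact ⟨c, by omega, by omega, (hget c).symm.trans hc⟩

theorem SIP.reverse {t : List ℤ} (h : SIP t) : SIP t.reverse := by
  rw [sip_iff] at h ⊢
  intro a b i hab ha hb
  have hb' : b < t.length := by simpa using (List.getElem?_eq_some_iff.1 hb).1
  rw [List.getElem?_reverse (hab.trans hb')] at ha
  rw [List.getElem?_reverse hb'] at hb
  obtain ⟨c, hbc, hca, hc⟩ := h _ _ i (by omega) hb ha
  refine ⟨t.length - 1 - c, by omega, by omega, ?_⟩
  rwa [List.getElem?_reverse (by omega), Nat.sub_sub_self (by omega)]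

theorem SIP.of_append_left {l t : List ℤ} (h : SIP (l ++ t)) : SIP l := by
  have hrev := h.reverse
  rw [List.reverse_append] at hrev
  exact List.reverse_reverse l ▸ hrev.of_append_right.reverse

theorem SIP.ne {p i : ℤ} {t : List ℤ} (h : SIP (p :: i :: t)) : i ≠ p := by
  rintro rfl
  obtain ⟨c, h0, h1, -⟩ := sip_iff.1 h 0 1 i one_pos rfl rfl
  omega

theorem SIP.erase_second {p i : ℤ} {t : List ℤ} (h : SIP (p :: i :: t)) (hi : i ≠ p + 1) :
    SIP (p :: t) := by
  rw [sip_iff] at h ⊢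
  rintro (_ | a) (_ | b) k hab ha hb
  · omega
  · obtain ⟨_ | _ | c, h0, h1, hc⟩ := h 0 (b + 2) k (by omega) ha hb
    · omega
    · simp_all
    · exact ⟨c + 1, by omega, by omega, hc⟩
  · omega
  · obtain ⟨_ | _ | c, h0, h1, hc⟩ := h (a + 2) (b + 2) k (by omega) ha hb
    · omega
    · omega
    · exact ⟨c + 1, by omega, by omega, hc⟩

/-- The end of the run `p + 1, p + 2, …` that is obtained by reading `t` from left to right and
taking every next element of the run where it first occurs. -/
def greedyRun : ℕ → List ℤ → ℕ
  | p, [] => p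
  | p, i :: t => if i = p + 1 then greedyRun (p + 1) t else greedyRun p t

theorem le_greedyRun (p : ℕ) (t : List ℤ) : p ≤ greedyRun p t := by
  induction t generalizing p with
  | nil => exact le_rfl
  | cons i t ih =>
    rw [greedyRun]
    split_ifs
    · exact (Nat.le_succ p).trans (ih _)
    · exact ih p

theorem greedyRun_le {p h : ℕ} {t : List ℤ} (hp : p ≤ h) (ht : ∀ i ∈ t, i ≤ (h : ℤ)) :
    greedyRun p t ≤ h := by
  induction t generalizing p with
  | nil => exact hp
  | cons i t ih =>
    rw [List.forall_mem_cons] at ht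
    rw [greedyRun]
    split_ifs with hi
    · exact ih (by omega) ht.2
    · exact ih hp ht.2

theorem cons_sublist_cons_iff_of_ne {α : Type*} {a b : α} {u t : List α} (h : a ≠ b) :
    (a :: u).Sublist (b :: t) ↔ (a :: u).Sublist t := by
  refine ⟨fun hs => ?_, List.Sublist.cons b⟩
  rcases List.sublist_cons_iff.1 hs with hs | ⟨v, hv, -⟩
  · exact hs
  · exact absurd (List.cons.inj hv).1 h

theorem cons_sublist_append_cons_iff {α : Type*} {a : α} {l : List α} (h : a ∉ l) (u s : List α) :
    (a :: u).Sublist (l ++ a :: s) ↔ u.Sublist s := by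
  induction l with
  | nil => exact List.cons_sublist_cons
  | cons b l ih =>
    rw [List.mem_cons, not_or] at h
    rw [List.cons_append, cons_sublist_cons_iff_of_ne h.1, ih h.2]

theorem range'_sublist_iff (p k : ℕ) (t : List ℤ) :
    ((List.range' (p + 1) k).map ((↑) : ℕ → ℤ)).Sublist t ↔ p + k ≤ greedyRun p t := by
  induction t generalizing p k with
  | nil => cases k <;> simp [greedyRun, List.range'_succ]
  | cons i t ih =>
    cases k with
    | zero => simpa using le_greedyRun p (i :: t)
    | succ k =>
      rw [List.range'_succ, List.map_cons, greedyRun]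
      split_ifs with hi
      · rw [hi, Nat.cast_succ, List.cons_sublist_cons, ih, Nat.succ_add_eq_add_succ]
      · rw [← ih p (k + 1), List.range'_succ, List.map_cons,
          cons_sublist_cons_iff_of_ne (by exact_mod_cast Ne.symm hi)]

theorem run_zero (p : ℕ) : run 0 p = 0 :: (List.range' 1 p).map ((↑) : ℕ → ℤ) := by
  simp [run, List.range_eq_range', List.range'_succ, ← List.map_eq_flatMap]

theorem consecutionsAt_zero {l s : List ℤ} (h : (0 : ℤ) ∉ l) :
    consecutionsAt 0 (l ++ 0 :: s) = (greedyRun 0 s : ℤ) := by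
  have hrun (p : ℕ) : (run 0 p).Sublist (l ++ 0 :: s) ↔ p ≤ greedyRun 0 s := by
    rw [run_zero, cons_sublist_append_cons_iff h, ← zero_add 1, range'_sublist_iff, zero_add]
  have hlen := ((hrun _).2 le_rfl).length_le
  rw [run_zero, List.length_cons, List.length_map, List.length_range'] at hlen
  rw [consecutionsAt, if_pos (List.mem_append_cons_self), Nat.cast_inj, Nat.findGreatest_eq_iff]
  exact ⟨(Nat.le_succ _).trans hlen, fun _ => (hrun _).2 le_rfl,
    fun k hk _ => by rw [hrun]; exact hk.not_ge⟩

theorem exists_split_of_pair_sublist {α : Type*} {a b : α} {t : List α} (h : [a, b].Sublist t) :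
    ∃ l s₁ s₂, t = l ++ a :: (s₁ ++ b :: s₂) := by
  obtain ⟨l, s, rfl, ha, hb⟩ := List.cons_sublist_iff.1 h
  obtain ⟨l, l', rfl⟩ := List.append_of_mem ha
  obtain ⟨s, s', rfl⟩ := List.append_of_mem (List.singleton_sublist.1 hb)
  exact ⟨l, l' ++ s, s', by simp⟩

theorem pair_sublist_or_of_mem {α : Type*} {a b : α} {t : List α} (ha : a ∈ t) (hb : b ∈ t)
    (hab : a ≠ b) : [a, b].Sublist t ∨ [b, a].Sublist t := by
  obtain ⟨l, s, rfl⟩ := List.append_of_mem ha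
  rw [List.mem_append, List.mem_cons] at hb
  rcases hb with hb | hb | hb
  · exact Or.inr ((List.singleton_sublist.2 hb).append
      (List.singleton_sublist.2 List.mem_cons_self))
  · exact absurd hb.symm hab
  · exact Or.inl (((List.singleton_sublist.2 hb).cons_cons a).trans
      (List.sublist_append_right _ _))

end IndexTuples

section Gates

variable {m n r : ℕ}

/-- A matrix that acts on the blocks of a vector like an elementary matrix of index `i ≥ 0`, except
that nothing is said about register `i` of the result. -/
structure IsGate (i : ℤ) (M : Matrix ((Fin m × Fin n) ⊕ Fin r) ((Fin m × Fin n) ⊕ Fin r) ℂ) :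
    Prop where
  other : ∀ (x : BlockVec m n r) (j : ℕ), (j : ℤ) ≠ i → (j : ℤ) + 1 ≠ i →
    reg (const M *ᵥ x) j = reg x j
  pred : ∀ (x : BlockVec m n r) (j : ℕ), (j : ℤ) + 1 = i → reg (const M *ᵥ x) j = reg x (j + 1)

theorem isGate_bigElem {i : ℤ} (h : 0 ≤ i) (h' : i < m) (Y : Matrix (Fin n) (Fin n) ℂ) :
    IsGate i (bigElem m r i Y) where
  other x _ _ _ := reg_bigElem_other x (by omega) (by omega)
  pred x j hj := by
    have hreg := reg_bigElem_natAbs_sub_one (i := i) (Y := Y) x (by omega) (by omega)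
    rw [if_pos (by omega), const_zero, Matrix.zero_mulVec, zero_add] at hreg
    rwa [show i.natAbs = j + 1 by omega, Nat.add_sub_cancel] at hreg

theorem isGate_fiedlerS (R : Realization m n r) {i : ℤ} (h : 0 ≤ i) (h' : i < m) :
    IsGate i (R.fiedlerS i) := by
  lift i to ℕ using h
  refine ⟨fun x j h1 h2 => R.reg_fiedlerS_other x (by omega) (by omega), fun x j hj => ?_⟩
  obtain rfl : i = j + 1 := by omega
  exact R.reg_fiedlerS_pred x j.succ_pos (by omega)

theorem const_prod_cons_mulVec {ι : Type*} [Fintype ι] [DecidableEq ι] (M : Matrix ι ι ℂ)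
    (L : List (Matrix ι ι ℂ)) (x : ι → ℂ[X]) :
    const (M :: L).prod *ᵥ x = const M *ᵥ const L.prod *ᵥ x := by
  rw [List.prod_cons, const_mul, Matrix.mulVec_mulVec]

theorem reg_gates_greedyRun
    (L : List (ℤ × Matrix ((Fin m × Fin n) ⊕ Fin r) ((Fin m × Fin n) ⊕ Fin r) ℂ))
    (hL : ∀ q ∈ L, IsGate q.1 q.2) (p : ℕ) (hp : SIP ((p : ℤ) :: L.map Prod.fst))
    (x : BlockVec m n r) :
    reg (const (L.map Prod.snd).prod *ᵥ x) p = reg x (greedyRun p (L.map Prod.fst)) := by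
  induction L generalizing p with
  | nil => rw [List.map_nil, List.prod_nil, const_one, Matrix.one_mulVec, List.map_nil, greedyRun]
  | cons q L ih =>
    rw [List.forall_mem_cons] at hL
    rw [List.map_cons] at hp
    rw [List.map_cons, const_prod_cons_mulVec, List.map_cons, greedyRun]
    split_ifs with h
    · rw [hL.1.pred _ p h.symm]
      refine ih hL.2 _ ?_
      rw [Nat.cast_succ, ← h]
      exact hp.of_append_right (l := [(p : ℤ)])
    · rw [hL.1.other _ p hp.ne.symm (Ne.symm h)]
      exact ih hL.2 p (hp.erase_second h)

end Gates

section Action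

/-- The part of a tuple to the right of the first occurrence of `j`. -/
def after (j : ℤ) : List ℤ → List ℤ
  | [] => []
  | i :: t => if i = j then t else after j t

theorem after_append_cons {j : ℤ} {l : List ℤ} (h : j ∉ l) (s : List ℤ) :
    after j (l ++ j :: s) = s := by
  induction l with
  | nil => exact if_pos rfl
  | cons i l ih =>
    rw [List.mem_cons, not_or] at h
    rw [List.cons_append, after, if_neg (Ne.symm h.1), ih h.2]

theorem exists_split_after {j : ℤ} {α : List ℤ} (hα : α.Nodup) (hj : j ∈ α) :
    ∃ l s, α = l ++ j :: s ∧ after j α = s ∧ j ∉ l ∧ j ∉ s := by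
  obtain ⟨l, s, rfl⟩ := List.append_of_mem hj
  rw [List.nodup_middle, List.nodup_cons, List.mem_append, not_or] at hα
  exact ⟨l, s, rfl, after_append_cons hα.1.1 s, hα.1⟩

theorem exists_split_after_pair {i j : ℤ} {α : List ℤ} (hα : α.Nodup) (hij : [i, j].Sublist α) :
    ∃ l s t, α = l ++ i :: (s ++ j :: t) ∧ after i α = s ++ j :: t ∧ after j α = t ∧
      (i ∉ l ∧ i ∉ s ∧ i ∉ t) ∧ j ∉ l ∧ j ∉ s ∧ j ∉ t := by
  obtain ⟨l, s, t, rfl⟩ := exists_split_of_pair_sublist hij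
  have hnotMem : (i ∉ l ∧ i ∉ s ∧ i ∉ t) ∧ j ∉ l ++ i :: s ∧ j ∉ t := by
    grind [List.nodup_append, List.nodup_cons]
  refine ⟨l, s, t, rfl, after_append_cons hnotMem.1.1 _, ?_, hnotMem.1, by simp_all, ?_⟩
  · rw [← List.cons_append, ← List.append_assoc]
    exact after_append_cons hnotMem.2.1 t
  · simp_all

namespace Realization

variable {m n r : ℕ} (R : Realization m n r)

/-- The action of a product of Fiedler matrices of the system matrix on polynomial vectors. -/
noncomputable def act (t : List ℤ) (x : BlockVec m n r) : BlockVec m n r :=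
  const (R.fiedlerSProd t) *ᵥ x

theorem act_nil (x : BlockVec m n r) : R.act [] x = x := by
  rw [act, fiedlerSProd, List.map_nil, List.prod_nil, const_one, Matrix.one_mulVec]

theorem act_cons (i : ℤ) (t : List ℤ) (x : BlockVec m n r) :
    R.act (i :: t) x = const (R.fiedlerS i) *ᵥ R.act t x :=
  const_prod_cons_mulVec _ _ x

theorem act_append (s t : List ℤ) (x : BlockVec m n r) :
    R.act (s ++ t) x = R.act s (R.act t x) := by
  rw [act, fiedlerSProd_append, const_mul, ← Matrix.mulVec_mulVec]
  rfl

theorem reg_act {t : List ℤ} (ht : ∀ i ∈ t, 0 ≤ i) {j : ℕ} (h1 : (j : ℤ) ∉ t)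
    (h2 : ((j + 1 : ℕ) : ℤ) ∉ t) (x : BlockVec m n r) : reg (R.act t x) j = reg x j := by
  induction t with
  | nil => rw [act_nil]
  | cons i t ih =>
    rw [List.forall_mem_cons] at ht
    rw [List.mem_cons, not_or] at h1 h2
    lift i to ℕ using ht.1
    rw [act_cons, R.reg_fiedlerS_other _ (mod_cast h1.1) (mod_cast h2.1), ih ht.2 h1.2 h2.2]

theorem statePart_act {t : List ℤ} (ht : ∀ i ∈ t, 0 < i) (x : BlockVec m n r) :
    statePart (R.act t x) = statePart x := by
  induction t with
  | nil => rw [act_nil]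
  | cons i t ih =>
    rw [List.forall_mem_cons] at ht
    lift i to ℕ using ht.1.le
    rw [act_cons, R.statePart_fiedlerS_pos _ (by exact_mod_cast ht.1), ih ht.2]

/-- Register `j` just before the factor of index `j` is applied, while the product of Fiedler
matrices along `α` acts on `y` from right to left. -/
noncomputable def gateIn (α : List ℤ) (y : BlockVec m n r) (j : ℕ) : Fin n → ℂ[X] :=
  reg (R.act (after j α) y) j

/-- Register `j` just after the factor of index `j` has been applied. -/
noncomputable def gateOut (α : List ℤ) (y : BlockVec m n r) (j : ℕ) : Fin n → ℂ[X] :=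
  reg (const (R.fiedlerS j) *ᵥ R.act (after j α) y) j

end Realization

end Action

section Permutations

theorem IsPermutationOf.natCast_mem {α : List ℤ} {m j : ℕ} (hα : IsPermutationOf α 0 (m - 1))
    (hj : j < m) : (j : ℤ) ∈ α :=
  (hα.2 j).2 (by omega)

theorem IsPermutationOf.nonneg {α : List ℤ} {b : ℤ} (hα : IsPermutationOf α 0 b) :
    ∀ i ∈ α, 0 ≤ i :=
  fun i hi => ((hα.2 i).1 hi).1

/-- The index `j` stands to the right of `j + 1` in `α`. -/
abbrev HasInversionAt (α : List ℤ) (j : ℕ) : Prop := [((j + 1 : ℕ) : ℤ), (j : ℤ)].Sublist α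

theorem IsPermutationOf.pair_sublist {α : List ℤ} {m j : ℕ} (hα : IsPermutationOf α 0 (m - 1))
    (hj : j + 1 < m) (h : ¬ HasInversionAt α j) : [(j : ℤ), ((j + 1 : ℕ) : ℤ)].Sublist α :=
  (pair_sublist_or_of_mem (hα.natCast_mem (by omega)) (hα.natCast_mem hj)
    (by omega)).resolve_right h

namespace Realization

variable {m n r : ℕ} (R : Realization m n r) {α : List ℤ} (y : BlockVec m n r) {j : ℕ}

section Ends

variable (hα : IsPermutationOf α 0 (m - 1)) (hm : 0 < m)
include hα hm

theorem exists_split_zero : ∃ l s, α = l ++ 0 :: s ∧ after 0 α = s ∧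
    (∀ i ∈ l, 0 < i) ∧ ∀ i ∈ s, 0 < i := by
  obtain ⟨l, s, hsplit, hafter, hl, hs⟩ :=
    exists_split_after hα.1 (Nat.cast_zero (R := ℤ) ▸ hα.natCast_mem hm)
  have hnonneg := hα.nonneg
  rw [hsplit, List.forall_mem_append, List.forall_mem_cons] at hnonneg
  exact ⟨l, s, hsplit, hafter,
    fun i hi => (hnonneg.1 i hi).lt_of_ne fun h => hl (h ▸ hi),
    fun i hi => (hnonneg.2.2 i hi).lt_of_ne fun h => hs (h ▸ hi)⟩

theorem gateOut_zero : R.gateOut α y 0 =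
    -(const (R.coeff 0) *ᵥ R.gateIn α y 0) - const R.C *ᵥ statePart y := by
  obtain ⟨l, s, -, hafter, -, hs⟩ := exists_split_zero hα hm
  rw [gateOut, gateIn, Nat.cast_zero, hafter, R.reg_fiedlerS_zero _ hm, R.statePart_act hs]

theorem statePart_act_permutation : statePart (R.act α y) =
    -(const R.B *ᵥ R.gateIn α y 0) - const R.A *ᵥ statePart y := by
  obtain ⟨l, s, hsplit, hafter, hl, hs⟩ := exists_split_zero hα hm
  rw [gateIn, Nat.cast_zero, hafter, hsplit, act_append, R.statePart_act hl, act_cons,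
    R.statePart_fiedlerS_zero _ hm, R.statePart_act hs]

theorem gateIn_last : R.gateIn α y (m - 1) = reg y (m - 1) := by
  obtain ⟨l, s, hsplit, hafter, -, hs⟩ :=
    exists_split_after hα.1 (hα.natCast_mem (Nat.sub_one_lt_of_lt hm))
  have hsub : ∀ i ∈ s, i ∈ α := by simp +contextual [hsplit]
  rw [gateIn, hafter]
  exact R.reg_act (fun i hi => hα.nonneg i (hsub i hi)) hs
    (fun h => by have := (hα.2 _).1 (hsub _ h); omega) y

theorem reg_act_last : reg (R.act α y) (m - 1) = R.gateOut α y (m - 1) := by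
  obtain ⟨l, s, hsplit, hafter, hl, -⟩ :=
    exists_split_after hα.1 (hα.natCast_mem (Nat.sub_one_lt_of_lt hm))
  have hsub : ∀ i ∈ l, i ∈ α := by simp +contextual [hsplit]
  rw [gateOut, hafter, hsplit, act_append, act_cons]
  exact R.reg_act (fun i hi => hα.nonneg i (hsub i hi)) hl
    (fun h => by have := (hα.2 _).1 (hsub _ h); omega) _

end Ends

theorem exists_split_pair {i k : ℤ} {b : ℤ} (hα : IsPermutationOf α 0 b)
    (hik : [i, k].Sublist α) :
    ∃ l s t, α = l ++ i :: (s ++ k :: t) ∧ after i α = s ++ k :: t ∧ after k α = t ∧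
      ((∀ a ∈ l, 0 ≤ a) ∧ (∀ a ∈ s, 0 ≤ a) ∧ ∀ a ∈ t, 0 ≤ a) ∧
      (i ∉ l ∧ i ∉ s ∧ i ∉ t) ∧ k ∉ l ∧ k ∉ s ∧ k ∉ t := by
  obtain ⟨l, s, t, hsplit, hi, hk, hnotMem⟩ := exists_split_after_pair hα.1 hik
  have hnonneg := hα.nonneg
  rw [hsplit, List.forall_mem_append, List.forall_mem_cons, List.forall_mem_append,
    List.forall_mem_cons] at hnonneg
  exact ⟨l, s, t, hsplit, hi, hk, ⟨hnonneg.1, hnonneg.2.2.1, hnonneg.2.2.2.2⟩, hnotMem⟩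

section Consecution

variable (hα : IsPermutationOf α 0 (m - 1)) (hj : j + 1 < m) (h : ¬ HasInversionAt α j)
include hα hj h

theorem gateIn_of_not_hasInversionAt : R.gateIn α y j = R.gateIn α y (j + 1) := by
  obtain ⟨l, s, t, -, hi, hk, ⟨-, hs, -⟩, ⟨-, his, -⟩, -, hks, -⟩ :=
    exists_split_pair hα (hα.pair_sublist hj h)
  rw [gateIn, gateIn, hi, hk, act_append, R.reg_act hs his hks, act_cons]
  exact R.reg_fiedlerS_pred _ j.succ_pos hj

theorem gateOut_of_not_hasInversionAt : R.gateOut α y (j + 1) =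
    reg y j - const (R.coeff (j + 1)) *ᵥ R.gateIn α y (j + 1) := by
  obtain ⟨l, s, t, -, -, hk, ⟨-, -, ht⟩, ⟨-, -, hit⟩, -, -, hkt⟩ :=
    exists_split_pair hα (hα.pair_sublist hj h)
  rw [gateOut, gateIn, R.reg_fiedlerS_self _ (Nat.add_pos_right j one_pos) hj, hk,
    Nat.add_sub_cancel, R.reg_act ht hit hkt]

theorem reg_act_of_not_hasInversionAt : reg (R.act α y) j = R.gateOut α y j := by
  obtain ⟨l, s, t, hsplit, hi, -, ⟨hl, -, -⟩, ⟨hil, -, -⟩, hkl, -, -⟩ :=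
    exists_split_pair hα (hα.pair_sublist hj h)
  rw [gateOut, hi, hsplit, act_append, R.reg_act hl hil hkl, act_cons]

end Consecution

section Inversion

variable (hα : IsPermutationOf α 0 (m - 1)) (h : HasInversionAt α j)
include hα h

theorem gateIn_of_hasInversionAt : R.gateIn α y j = reg y j := by
  obtain ⟨l, s, t, -, -, hk, ⟨-, -, ht⟩, ⟨-, -, hit⟩, -, -, hkt⟩ := exists_split_pair hα h
  rw [gateIn, hk, R.reg_act ht hkt hit]

theorem gateOut_of_hasInversionAt (hj : j + 1 < m) : R.gateOut α y (j + 1) =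
    R.gateOut α y j - const (R.coeff (j + 1)) *ᵥ R.gateIn α y (j + 1) := by
  obtain ⟨l, s, t, -, hi, hk, ⟨-, hs, -⟩, ⟨-, his, -⟩, -, hks, -⟩ := exists_split_pair hα h
  rw [gateOut, gateOut, gateIn, R.reg_fiedlerS_self _ (Nat.add_pos_right j one_pos) hj, hi,
    hk, Nat.add_sub_cancel, act_append, R.reg_act hs hks his, act_cons]

theorem reg_act_of_hasInversionAt (hj : j + 1 < m) :
    reg (R.act α y) j = R.gateIn α y (j + 1) := by
  obtain ⟨l, s, t, hsplit, hi, -, ⟨hl, -, -⟩, ⟨hil, -, -⟩, hkl, -, -⟩ := exists_split_pair hα h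
  rw [gateIn, hi, hsplit, act_append, R.reg_act hl hkl hil, act_cons]
  exact R.reg_fiedlerS_pred _ j.succ_pos hj

end Inversion

end Realization

end Permutations

section Degrees

variable {κ : Type*} [Fintype κ]

theorem vecDegree_zero : vecDegree (0 : κ → ℂ[X]) = 0 :=
  Nat.le_zero.1 (vecDegree_le_iff.2 fun _ => natDegree_zero.le)

theorem vecDegree_neg (v : κ → ℂ[X]) : vecDegree (-v) = vecDegree v := by
  simp only [vecDegree, Pi.neg_apply, natDegree_neg]

theorem vecDegree_add_le (v w : κ → ℂ[X]) :
    vecDegree (v + w) ≤ max (vecDegree v) (vecDegree w) :=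
  vecDegree_le_iff.2 fun k => (natDegree_add_le _ _).trans
    (max_le_max (natDegree_le_vecDegree v k) (natDegree_le_vecDegree w k))

theorem exists_natDegree_eq_vecDegree {v : κ → ℂ[X]} (hv : v ≠ 0) :
    ∃ k, v k ≠ 0 ∧ (v k).natDegree = vecDegree v := by
  obtain ⟨k₀, hk₀⟩ := Function.ne_iff.1 hv
  obtain ⟨k, -, hk⟩ := Finset.exists_mem_eq_sup Finset.univ ⟨k₀, Finset.mem_univ k₀⟩
    fun k => (v k).natDegree
  by_cases h : v k = 0
  · refine ⟨k₀, hk₀, (natDegree_le_vecDegree v k₀).antisymm ?_⟩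
    rw [vecDegree, hk, h, natDegree_zero]
    exact Nat.zero_le _
  · exact ⟨k, h, hk.symm⟩

theorem vecDegree_X_pow_smul_le (v : κ → ℂ[X]) (c : ℕ) :
    vecDegree ((X ^ c : ℂ[X]) • v) ≤ vecDegree v + c :=
  vecDegree_le_iff.2 fun k => by
    rw [Pi.smul_apply, smul_eq_mul, add_comm]
    exact natDegree_mul_le.trans (add_le_add (natDegree_X_pow_le c) (natDegree_le_vecDegree v k))

theorem vecDegree_X_pow_smul {v : κ → ℂ[X]} (hv : v ≠ 0) (c : ℕ) :
    vecDegree ((X ^ c : ℂ[X]) • v) = vecDegree v + c := by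
  obtain ⟨k, hk, hdeg⟩ := exists_natDegree_eq_vecDegree hv
  refine (vecDegree_X_pow_smul_le v c).antisymm ?_
  rw [← hdeg, ← natDegree_mul_X_pow _ hk, mul_comm]
  exact natDegree_le_vecDegree ((X ^ c : ℂ[X]) • v) k

omit [Fintype κ] in
theorem X_pow_smul_injective (c : ℕ) :
    Function.Injective fun v : κ → ℂ[X] => (X ^ c : ℂ[X]) • v :=
  smul_right_injective _ (pow_ne_zero c X_ne_zero)

theorem vecDegree_sumElim {ι : Type*} [Fintype ι] (u : ι → ℂ[X]) (w : κ → ℂ[X]) :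
    vecDegree (Sum.elim u w) = max (vecDegree u) (vecDegree w) := by
  refine le_antisymm (vecDegree_le_iff.2 ?_) (max_le ?_ ?_)
  · rintro (k | k)
    · exact le_max_of_le_left (natDegree_le_vecDegree u k)
    · exact le_max_of_le_right (natDegree_le_vecDegree w k)
  · exact vecDegree_le_iff.2 fun k => natDegree_le_vecDegree (Sum.elim u w) (Sum.inl k)
  · exact vecDegree_le_iff.2 fun k => natDegree_le_vecDegree (Sum.elim u w) (Sum.inr k)

variable {m n r : ℕ} (y : BlockVec m n r)

theorem vecDegree_reg_le (j : ℕ) : vecDegree (reg y j) ≤ vecDegree y :=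
  vecDegree_le_iff.2 fun k => by
    rcases lt_or_ge j m with hj | hj
    · rw [reg_apply y hj]
      exact natDegree_le_vecDegree y _
    · simp [reg_of_le y hj]

variable {y} in
theorem vecDegree_le_of_reg {d : ℕ} (h : ∀ j < m, vecDegree (reg y j) ≤ d)
    (hs : vecDegree (statePart y) ≤ d) : vecDegree y ≤ d := by
  rw [vecDegree_le_iff] at hs ⊢
  rintro (⟨a, k⟩ | k)
  · rw [apply_inl y]
    exact vecDegree_le_iff.1 (h _ (by omega)) k
  · exact hs k

end Degrees

section InversionCount

/-- The number of `j < k` at which `α` has an inversion. -/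
def inversionsBelow (α : List ℤ) (k : ℕ) : ℕ := Nat.count (HasInversionAt α) k

/-- The number of `j < k` at which `α` has no inversion; for a permutation of `{0, …, k}` these are
its consecutions. -/
def consecutionsBelow (α : List ℤ) (k : ℕ) : ℕ := Nat.count (¬ HasInversionAt α ·) k

variable (α : List ℤ) {j : ℕ}

theorem consecutionsBelow_add_inversionsBelow (k : ℕ) :
    consecutionsBelow α k + inversionsBelow α k = k := by
  rw [consecutionsBelow, inversionsBelow, Nat.count_eq_card_filter_range,
    Nat.count_eq_card_filter_range, add_comm, Finset.card_filter_add_card_filter_not,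
    Finset.card_range]

theorem inversionsBelow_mono : Monotone (inversionsBelow α) := Nat.count_monotone _

variable {α}

theorem inversionsBelow_succ_of_hasInversionAt (h : HasInversionAt α j) :
    inversionsBelow α (j + 1) = inversionsBelow α j + 1 := by
  rw [inversionsBelow, Nat.count_succ, if_pos h]; rfl

theorem inversionsBelow_succ_of_not_hasInversionAt (h : ¬ HasInversionAt α j) :
    inversionsBelow α (j + 1) = inversionsBelow α j := by
  rw [inversionsBelow, Nat.count_succ, if_neg h]; rfl

theorem consecutionsBelow_succ_of_hasInversionAt (h : HasInversionAt α j) :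
    consecutionsBelow α (j + 1) = consecutionsBelow α j := by
  rw [consecutionsBelow, Nat.count_succ, if_neg (not_not.2 h)]; rfl

theorem consecutionsBelow_succ_of_not_hasInversionAt (h : ¬ HasInversionAt α j) :
    consecutionsBelow α (j + 1) = consecutionsBelow α j + 1 := by
  rw [consecutionsBelow, Nat.count_succ, if_pos h]; rfl

theorem totalInversions_eq {m : ℕ} (hα : IsPermutationOf α 0 (m - 1)) :
    totalInversions α = inversionsBelow α (m - 1) := by
  rw [inversionsBelow, Nat.count_eq_card_filter_range, totalInversions]
  symm
  refine Finset.card_bij (fun j _ => (j : ℤ)) ?_ (fun _ _ _ _ h => by exact_mod_cast h) ?_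
  · intro j hj
    rw [Finset.mem_filter, Finset.mem_range] at hj
    rw [Finset.mem_filter, List.mem_toFinset, hα.2]
    exact ⟨by omega, hj.2⟩
  · intro i hi
    rw [Finset.mem_filter, List.mem_toFinset, hα.2] at hi
    obtain ⟨⟨hnonneg, -⟩, hinv⟩ := hi
    have hlt := (hα.2 (i + 1)).1 (hinv.subset List.mem_cons_self)
    lift i to ℕ using hnonneg
    exact ⟨i, by rw [Finset.mem_filter, Finset.mem_range]; exact ⟨by omega, hinv⟩, rfl⟩

end InversionCount

/-! ### Null vectors of Fiedler pencils -/

section Recovery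

variable {m n r : ℕ}

/-- The matrix that extracts block `k` (counted from 1) and the state part of a vector. -/
noncomputable def recoveryMatrix (m n r : ℕ) (k : ℤ) :
    Matrix (Fin n ⊕ Fin r) ((Fin m × Fin n) ⊕ Fin r) ℂ[X] :=
  Matrix.fromBlocks (blockRow m k 1) 0 0 1

theorem recoveryMatrix_mulVec {j : ℕ} (hj : j < m) (x : BlockVec m n r) :
    recoveryMatrix m n r (m - j) *ᵥ x = Sum.elim (reg x j) (statePart x) := by
  have hblock (a : Fin m) : (a : ℤ) + 1 = m - j ↔ a = ⟨m - 1 - j, by omega⟩ := by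
    simp only [Fin.ext_iff]
    omega
  have hrow : blockRow m (m - j) (1 : Matrix (Fin n) (Fin n) ℂ[X]) *ᵥ (x ∘ Sum.inl) = reg x j := by
    funext k
    simp [Matrix.mulVec, dotProduct, Fintype.sum_prod_type, blockRow, hblock, Matrix.one_apply,
      reg_apply x hj]
  rw [recoveryMatrix, Matrix.fromBlocks_mulVec, hrow, Matrix.zero_mulVec, Matrix.zero_mulVec,
    Matrix.one_mulVec, add_zero, zero_add]
  rfl

theorem recoveryMatrix_mul_fromRows {p : ℕ} (k : ℤ) (Zmn : Matrix (Fin m × Fin n) (Fin p) ℂ[X])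
    (Zr : Matrix (Fin r) (Fin p) ℂ[X]) :
    recoveryMatrix m n r k * Matrix.fromRows Zmn Zr =
      Matrix.fromRows (blockRow m k (1 : Matrix (Fin n) (Fin n) ℂ[X]) * Zmn) Zr := by
  simp [recoveryMatrix, Matrix.fromBlocks_mul_fromRows]

end Recovery

namespace Realization

variable {m n r : ℕ} (R : Realization m n r)

section SystemMatrix

variable (u : Fin n → ℂ[X]) (w : Fin r → ℂ[X])

/-- `C w + (A_0 + λ A_1 + ⋯ + λ^j A_j) u`, the first block row of the system matrix applied to
`(u, w)`, with `P(λ)` truncated after `λ^j`. -/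
noncomputable def partialSum (j : ℕ) : Fin n → ℂ[X] :=
  ∑ k ∈ Finset.range (j + 1), (X ^ k : ℂ[X]) • (const (R.coeff k) *ᵥ u) + const R.C *ᵥ w

theorem partialSum_zero : R.partialSum u w 0 = const (R.coeff 0) *ᵥ u + const R.C *ᵥ w := by
  rw [partialSum, Finset.sum_range_one, pow_zero, one_smul]

theorem partialSum_succ (j : ℕ) : R.partialSum u w (j + 1) =
    R.partialSum u w j + (X ^ (j + 1) : ℂ[X]) • (const (R.coeff (j + 1)) *ᵥ u) := by
  rw [partialSum, Finset.sum_range_succ, add_right_comm, partialSum]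

theorem systemMatrix_mulVec_eq_zero_iff : R.systemMatrix *ᵥ Sum.elim u w = 0 ↔
    R.partialSum u w m = 0 ∧
      const R.B *ᵥ u + const R.A *ᵥ w = (X : ℂ[X]) • (const R.E *ᵥ w) := by
  rw [systemMatrix, Matrix.fromBlocks_mulVec, Sum.elim_comp_inl, Sum.elim_comp_inr,
    ← Sum.elim_zero_zero, Sum.elim_eq_iff, Matrix.sub_mulVec, Matrix.smul_mulVec,
    ← add_sub_assoc, sub_eq_zero, polyPart, Matrix.sum_mulVec]
  simp only [Matrix.smul_mulVec, partialSum]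

variable {u w}

theorem vecDegree_state_lt (hw : w ≠ 0)
    (h : const R.B *ᵥ u + const R.A *ᵥ w = (X : ℂ[X]) • (const R.E *ᵥ w)) :
    vecDegree w < vecDegree u := by
  have hEw : const R.E *ᵥ w ≠ 0 := mt (eq_zero_of_const_mulVec_eq_zero R.E_nonsingular) hw
  have hdeg := vecDegree_X_pow_smul hEw 1
  rw [pow_one, ← h, vecDegree_const_mulVec R.E_nonsingular] at hdeg
  have hle := vecDegree_add_le (const R.B *ᵥ u) (const R.A *ᵥ w)
  have hB := vecDegree_const_mulVec_le R.B u
  have hA := vecDegree_const_mulVec_le R.A w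
  omega

theorem vecDegree_state_le
    (h : const R.B *ᵥ u + const R.A *ᵥ w = (X : ℂ[X]) • (const R.E *ᵥ w)) :
    vecDegree w ≤ vecDegree u := by
  rcases eq_or_ne w 0 with rfl | hw
  · rw [vecDegree_zero]
    exact Nat.zero_le _
  · exact (R.vecDegree_state_lt hw h).le

theorem vecDegree_partialSum_le (hw : vecDegree w ≤ vecDegree u) (j : ℕ) :
    vecDegree (R.partialSum u w j) ≤ vecDegree u + j := by
  induction j with
  | zero =>
    rw [partialSum_zero]
    exact (vecDegree_add_le _ _).trans (max_le (vecDegree_const_mulVec_le _ u)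
      ((vecDegree_const_mulVec_le _ w).trans hw))
  | succ j ih =>
    rw [partialSum_succ]
    exact (vecDegree_add_le _ _).trans (max_le (ih.trans (by omega))
      ((vecDegree_X_pow_smul_le _ _).trans
        (Nat.add_le_add_right (vecDegree_const_mulVec_le _ u) _)))

end SystemMatrix

/-- The Fiedler pencil `λ 𝕄^S_{-m} - 𝕄^S_α`. -/
noncomputable def fiedlerPencil (α : List ℤ) :
    Matrix ((Fin m × Fin n) ⊕ Fin r) ((Fin m × Fin n) ⊕ Fin r) ℂ[X] :=
  (X : ℂ[X]) • const (R.fiedlerS (-m)) - const (R.fiedlerSProd α)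

theorem fiedlerPencil_mulVec_eq_zero_iff (hm : 0 < m) (α : List ℤ) (y : BlockVec m n r) :
    R.fiedlerPencil α *ᵥ y = 0 ↔
      (∀ j, j + 1 < m → reg (R.act α y) j = (X : ℂ[X]) • reg y j) ∧
      reg (R.act α y) (m - 1) = (X : ℂ[X]) • (const (R.coeff m) *ᵥ reg y (m - 1)) ∧
      statePart (R.act α y) = -((X : ℂ[X]) • (const R.E *ᵥ statePart y)) := by
  have hstate : statePart ((X : ℂ[X]) • (const (R.fiedlerS (-m)) *ᵥ y)) =
      -((X : ℂ[X]) • (const R.E *ᵥ statePart y)) := by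
    rw [← smul_neg, ← R.statePart_fiedlerS_neg_last y hm]
    rfl
  rw [fiedlerPencil, Matrix.sub_mulVec, Matrix.smul_mulVec, sub_eq_zero, eq_comm, ← act]
  constructor
  · intro h
    rw [h]
    exact ⟨fun j hj => by rw [reg_smul, R.reg_fiedlerS_neg_other _ hj],
      by rw [reg_smul, R.reg_fiedlerS_neg_last _ hm], hstate⟩
  · rintro ⟨hreg, hlast, hs⟩
    refine ext_reg (fun j hj => ?_) (hs.trans hstate.symm)
    rw [reg_smul]
    rcases Nat.lt_or_ge (j + 1) m with hj' | hj'
    · rw [hreg j hj', R.reg_fiedlerS_neg_other _ hj']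
    · obtain rfl : j = m - 1 := by omega
      rw [hlast, R.reg_fiedlerS_neg_last _ hm]

end Realization

section Lift

/-- The shape of a null vector `y` of the Fiedler pencil of `α` that corresponds to the null vector
`(u, statePart y)` of the system matrix: up to powers of `λ`, each register of `y` is `u` or a
negated partial sum. -/
structure IsFiedlerLift {m n r : ℕ} (R : Realization m n r) (α : List ℤ) (u : Fin n → ℂ[X])
    (y : BlockVec m n r) : Prop where
  reg_eq : ∀ j < m, HasInversionAt α j ∨ j + 1 = m →
    reg y j = (X ^ inversionsBelow α j : ℂ[X]) • u
  smul_reg : ∀ j, j + 1 < m → ¬ HasInversionAt α j →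
    (X ^ (consecutionsBelow α j + 1) : ℂ[X]) • reg y j = -R.partialSum u (statePart y) j

variable {m n r : ℕ} {R : Realization m n r} {α : List ℤ} {u : Fin n → ℂ[X]}
  {y : BlockVec m n r} {j : ℕ}

namespace Realization

variable (hα : IsPermutationOf α 0 (m - 1))
include hα

theorem smul_gateOut_eq (hin : ∀ j < m, R.gateIn α y j = (X ^ inversionsBelow α j : ℂ[X]) • u)
    (hreg : ∀ j, j + 1 < m → ¬ HasInversionAt α j →
      (X ^ consecutionsBelow α j : ℂ[X]) • R.gateOut α y j = -R.partialSum u (statePart y) j →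
      (X ^ (consecutionsBelow α j + 1) : ℂ[X]) • reg y j = -R.partialSum u (statePart y) j)
    (hj : j < m) :
    (X ^ consecutionsBelow α j : ℂ[X]) • R.gateOut α y j = -R.partialSum u (statePart y) j := by
  induction j with
  | zero =>
    have hin0 := hin 0 hj
    rw [inversionsBelow, Nat.count_zero, pow_zero, one_smul] at hin0
    rw [consecutionsBelow, Nat.count_zero, pow_zero, one_smul, R.gateOut_zero y hα hj, hin0,
      partialSum_zero, neg_add']
  | succ j ih =>
    have hterm : (X ^ consecutionsBelow α (j + 1) : ℂ[X]) •
        (const (R.coeff (j + 1)) *ᵥ R.gateIn α y (j + 1)) =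
        (X ^ (j + 1) : ℂ[X]) • (const (R.coeff (j + 1)) *ᵥ u) := by
      rw [hin _ hj, Matrix.mulVec_smul, smul_smul, ← pow_add,
        consecutionsBelow_add_inversionsBelow]
    have ih := ih (Nat.lt_of_succ_lt hj)
    rw [partialSum_succ, neg_add']
    by_cases h : HasInversionAt α j
    · rw [R.gateOut_of_hasInversionAt y hα h hj, smul_sub, hterm,
        consecutionsBelow_succ_of_hasInversionAt h, ih]
    · rw [R.gateOut_of_not_hasInversionAt y hα hj h, smul_sub, hterm,
        consecutionsBelow_succ_of_not_hasInversionAt h, hreg j hj h ih]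

variable (hm : 0 < m) (hy : R.fiedlerPencil α *ᵥ y = 0)
include hm hy

theorem gateIn_eq_smul_gateIn_zero (hj : j < m) :
    R.gateIn α y j = (X ^ inversionsBelow α j : ℂ[X]) • R.gateIn α y 0 := by
  induction j with
  | zero => rw [inversionsBelow, Nat.count_zero, pow_zero, one_smul]
  | succ j ih =>
    have ih := ih (Nat.lt_of_succ_lt hj)
    by_cases h : HasInversionAt α j
    · rw [← R.reg_act_of_hasInversionAt y hα h hj,
        ((R.fiedlerPencil_mulVec_eq_zero_iff hm α y).1 hy).1 j hj,
        ← R.gateIn_of_hasInversionAt y hα h, ih, smul_smul, ← pow_succ',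
        inversionsBelow_succ_of_hasInversionAt h]
    · rw [← R.gateIn_of_not_hasInversionAt y hα hj h, ih,
        inversionsBelow_succ_of_not_hasInversionAt h]

theorem isFiedlerLift_of_mulVec_eq_zero : IsFiedlerLift R α (R.gateIn α y 0) y := by
  have hin (j : ℕ) (hj : j < m) := gateIn_eq_smul_gateIn_zero hα hm hy hj
  have hreg (j : ℕ) (hj : j + 1 < m) (h : ¬ HasInversionAt α j)
      (hout : (X ^ consecutionsBelow α j : ℂ[X]) • R.gateOut α y j =
        -R.partialSum (R.gateIn α y 0) (statePart y) j) :
      (X ^ (consecutionsBelow α j + 1) : ℂ[X]) • reg y j =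
        -R.partialSum (R.gateIn α y 0) (statePart y) j := by
    rw [← hout, ← R.reg_act_of_not_hasInversionAt y hα hj h,
      ((R.fiedlerPencil_mulVec_eq_zero_iff hm α y).1 hy).1 j hj, smul_smul, pow_succ]
  refine ⟨fun j hj h => ?_, fun j hj h =>
    hreg j hj h (smul_gateOut_eq hα hin hreg (Nat.lt_of_succ_lt hj))⟩
  rw [← hin j hj]
  rcases h with h | rfl
  · exact (R.gateIn_of_hasInversionAt y hα h).symm
  · exact (R.gateIn_last y hα hm).symm

end Realization

namespace IsFiedlerLift

variable (hy : IsFiedlerLift R α u y)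
include hy

theorem eq_zero (hu : u = 0) (hw : statePart y = 0) : y = 0 := by
  refine ext_reg (fun j hj => ?_) hw
  rw [reg_zero]
  by_cases h : HasInversionAt α j ∨ j + 1 = m
  · rw [hy.reg_eq j hj h, hu, smul_zero]
  · rw [not_or] at h
    apply X_pow_smul_injective (consecutionsBelow α j + 1)
    simp only [hy.smul_reg j (by omega) h.1, hu, hw, Realization.partialSum, Matrix.mulVec_zero,
      smul_zero, Finset.sum_const_zero, add_zero, neg_zero]

theorem vecDegree_reg_le_add (hw : vecDegree (statePart y) ≤ vecDegree u) (hj : j < m) :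
    vecDegree (reg y j) ≤ vecDegree u + inversionsBelow α j := by
  by_cases h : HasInversionAt α j ∨ j + 1 = m
  · rw [hy.reg_eq j hj h]
    exact vecDegree_X_pow_smul_le u _
  · rw [not_or] at h
    rcases eq_or_ne (reg y j) 0 with hz | hz
    · rw [hz, vecDegree_zero]
      exact Nat.zero_le _
    · have hdeg := vecDegree_X_pow_smul hz (consecutionsBelow α j + 1)
      rw [hy.smul_reg j (by omega) h.1, vecDegree_neg] at hdeg
      have hle := R.vecDegree_partialSum_le hw j
      have hcount := consecutionsBelow_add_inversionsBelow α j
      omega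

theorem vecDegree_eq (hm : 0 < m) (hu : u ≠ 0) (hw : vecDegree (statePart y) ≤ vecDegree u) :
    vecDegree y = vecDegree u + inversionsBelow α (m - 1) := by
  apply le_antisymm
  · refine vecDegree_le_of_reg (fun j hj => ?_) (Nat.le_add_right_of_le hw)
    exact (hy.vecDegree_reg_le_add hw hj).trans
      (Nat.add_le_add_left (inversionsBelow_mono α (Nat.le_sub_one_of_lt hj)) _)
  · rw [← vecDegree_X_pow_smul hu, ← hy.reg_eq (m - 1) (by omega) (.inr (by omega))]
    exact vecDegree_reg_le y _

variable (hα : IsPermutationOf α 0 (m - 1))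
include hα

theorem gateIn_eq (hj : j < m) : R.gateIn α y j = (X ^ inversionsBelow α j : ℂ[X]) • u := by
  induction Nat.le_sub_one_of_lt hj using Nat.decreasingInduction with
  | self => rw [R.gateIn_last y hα (by omega), hy.reg_eq (m - 1) (by omega) (.inr (by omega))]
  | of_succ k hk ih =>
    by_cases h : HasInversionAt α k
    · rw [R.gateIn_of_hasInversionAt y hα h, hy.reg_eq k (by omega) (.inl h)]
    · rw [R.gateIn_of_not_hasInversionAt y hα (by omega) h, ih (by omega),
        inversionsBelow_succ_of_not_hasInversionAt h]

theorem smul_gateOut_eq (hj : j < m) :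
    (X ^ consecutionsBelow α j : ℂ[X]) • R.gateOut α y j = -R.partialSum u (statePart y) j :=
  Realization.smul_gateOut_eq hα (fun _ => hy.gateIn_eq hα)
    (fun k hk h _ => hy.smul_reg k hk h) hj

theorem reg_act_eq (hj : j + 1 < m) : reg (R.act α y) j = (X : ℂ[X]) • reg y j := by
  by_cases h : HasInversionAt α j
  · rw [R.reg_act_of_hasInversionAt y hα h hj, hy.gateIn_eq hα hj,
      inversionsBelow_succ_of_hasInversionAt h, hy.reg_eq j (by omega) (.inl h), smul_smul,
      ← pow_succ']
  · apply X_pow_smul_injective (consecutionsBelow α j)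
    simp only [R.reg_act_of_not_hasInversionAt y hα hj h, smul_smul, ← pow_succ,
      hy.smul_reg j hj h]
    exact hy.smul_gateOut_eq hα (Nat.lt_of_succ_lt hj)

theorem reg_act_last_eq_iff (hm : 0 < m) :
    reg (R.act α y) (m - 1) = (X : ℂ[X]) • (const (R.coeff m) *ᵥ reg y (m - 1)) ↔
      R.partialSum u (statePart y) m = 0 := by
  obtain ⟨k, rfl⟩ := Nat.exists_eq_add_one.2 hm
  have hexp : consecutionsBelow α k + 1 + inversionsBelow α k = k + 1 := by
    rw [add_right_comm, consecutionsBelow_add_inversionsBelow]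
  rw [← (X_pow_smul_injective (consecutionsBelow α k)).eq_iff, R.reg_act_last y hα hm]
  simp only [Nat.add_sub_cancel]
  rw [hy.smul_gateOut_eq hα k.lt_succ_self, hy.reg_eq k k.lt_succ_self (.inr rfl),
    Matrix.mulVec_smul, smul_smul, smul_smul, ← pow_succ, ← pow_add, hexp,
    Realization.partialSum_succ, neg_eq_iff_add_eq_zero]

theorem fiedlerPencil_mulVec_eq_zero_iff (hm : 0 < m) :
    R.fiedlerPencil α *ᵥ y = 0 ↔ R.systemMatrix *ᵥ Sum.elim u (statePart y) = 0 := by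
  have hu : R.gateIn α y 0 = u := by
    rw [hy.gateIn_eq hα hm, inversionsBelow, Nat.count_zero, pow_zero, one_smul]
  rw [R.fiedlerPencil_mulVec_eq_zero_iff hm, hy.reg_act_last_eq_iff hα hm,
    R.statePart_act_permutation y hα hm, hu, ← neg_add', neg_inj,
    R.systemMatrix_mulVec_eq_zero_iff, and_iff_right fun j hj => hy.reg_act_eq hα hj]

end IsFiedlerLift

namespace Realization

theorem neg_partialSum_eq {w : Fin r → ℂ[X]} (h : R.partialSum u w m = 0) (hj : j < m) :
    -R.partialSum u w j = (X ^ (j + 1) : ℂ[X]) •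
      ∑ k ∈ Finset.Ico (j + 1) (m + 1), (X ^ (k - (j + 1)) : ℂ[X]) • (const (R.coeff k) *ᵥ u) := by
  rw [Finset.smul_sum, neg_eq_iff_add_eq_zero, ← h, partialSum, partialSum, add_right_comm,
    ← Finset.sum_range_add_sum_Ico _ (Nat.succ_le_succ hj.le)]
  congr 2
  refine Finset.sum_congr rfl fun k hk => ?_
  rw [smul_smul, ← pow_add, Nat.add_sub_cancel' (Finset.mem_Ico.1 hk).1]

theorem exists_isFiedlerLift (α : List ℤ) {w : Fin r → ℂ[X]} (h : R.partialSum u w m = 0) :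
    ∃ y, statePart y = w ∧ IsFiedlerLift R α u y := by
  let y : BlockVec m n r := ofReg (fun j => (X ^ inversionsBelow α j : ℂ[X]) •
    if HasInversionAt α j ∨ j + 1 = m then u else ∑ k ∈ Finset.Ico (j + 1) (m + 1),
      (X ^ (k - (j + 1)) : ℂ[X]) • (const (R.coeff k) *ᵥ u)) w
  have hw : statePart y = w := statePart_ofReg _ _
  refine ⟨y, hw, fun j hj hinv => ?_, fun j hj hinv => ?_⟩
  · rw [reg_ofReg _ _ hj, if_pos hinv]
  · rw [hw, R.neg_partialSum_eq h (Nat.lt_of_succ_lt hj), reg_ofReg _ _ (Nat.lt_of_succ_lt hj),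
      if_neg (not_or.2 ⟨hinv, hj.ne⟩), smul_smul, ← pow_add, add_right_comm,
      consecutionsBelow_add_inversionsBelow]

variable (R)

theorem recoveryMatrix_after_zero_mulVec (hm : 0 < m) (hα : IsPermutationOf α 0 (m - 1))
    (y : BlockVec m n r) :
    (recoveryMatrix m n r m * const (R.fiedlerSProd (after 0 α))) *ᵥ y =
      Sum.elim (R.gateIn α y 0) (statePart y) := by
  obtain ⟨l, s, -, hafter, -, hs⟩ := exists_split_zero hα hm
  have hrec := recoveryMatrix_mulVec hm (R.act (after 0 α) y)
  rw [Nat.cast_zero, sub_zero] at hrec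
  rw [← Matrix.mulVec_mulVec, ← act, hrec, gateIn, hafter, R.statePart_act hs, Nat.cast_zero,
    hafter]

theorem isDegreeShift_fiedlerPencil (hm : 0 < m) (hα : IsPermutationOf α 0 (m - 1)) :
    IsDegreeShift (recoveryMatrix m n r m * const (R.fiedlerSProd (after 0 α)))
      (totalInversions α) (rightNull (toRat (R.fiedlerPencil α)))
      (rightNull (toRat R.systemMatrix)) := by
  have hlift (y : BlockVec m n r) (hy : ratVec y ∈ rightNull (toRat (R.fiedlerPencil α))) :
      IsFiedlerLift R α (R.gateIn α y 0) y ∧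
        R.systemMatrix *ᵥ Sum.elim (R.gateIn α y 0) (statePart y) = 0 := by
    have hnull := ratVec_mem_rightNull.1 hy
    have hL := isFiedlerLift_of_mulVec_eq_zero hα hm hnull
    exact ⟨hL, (hL.fiedlerPencil_mulVec_eq_zero_iff hα hm).1 hnull⟩
  constructor
  · intro y hy
    rw [R.recoveryMatrix_after_zero_mulVec hm hα, ratVec_mem_rightNull]
    exact (hlift y hy).2
  · intro v hv
    obtain ⟨u, w, rfl⟩ : ∃ u w, v = Sum.elim u w := ⟨_, _, (Sum.elim_comp_inl_inr v).symm⟩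
    rw [ratVec_mem_rightNull] at hv
    obtain ⟨y, rfl, hy⟩ :=
      R.exists_isFiedlerLift α ((R.systemMatrix_mulVec_eq_zero_iff u w).1 hv).1
    refine ⟨y, ratVec_mem_rightNull.2 ((hy.fiedlerPencil_mulVec_eq_zero_iff hα hm).2 hv), ?_⟩
    rw [R.recoveryMatrix_after_zero_mulVec hm hα, hy.gateIn_eq hα hm, inversionsBelow,
      Nat.count_zero, pow_zero, one_smul]
  · intro y hy h0
    rw [R.recoveryMatrix_after_zero_mulVec hm hα, ← Sum.elim_zero_zero, Sum.elim_eq_iff] at h0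
    exact (hlift y hy).1.eq_zero h0.1 h0.2
  · intro y hy hne
    obtain ⟨hL, hnull⟩ := hlift y hy
    have hw := R.vecDegree_state_le ((R.systemMatrix_mulVec_eq_zero_iff _ _).1 hnull).2
    have hu : R.gateIn α y 0 ≠ 0 := fun h0 => hne <| hL.eq_zero h0 <| by_contra fun hw0 => by
      have hlt := R.vecDegree_state_lt hw0 ((R.systemMatrix_mulVec_eq_zero_iff _ _).1 hnull).2
      rw [h0, vecDegree_zero] at hlt
      exact Nat.not_lt_zero _ hlt
    rw [R.recoveryMatrix_after_zero_mulVec hm hα, vecDegree_sumElim, max_eq_left hw,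
      totalInversions_eq hα, hL.vecDegree_eq hm hu hw]

end Realization

end Lift

/-! ### Generalized Fiedler pencils -/

section NegRev

theorem mem_negRev {t : List ℤ} {i : ℤ} : i ∈ negRev t ↔ -i ∈ t := by
  rw [negRev, List.mem_map_of_involutive neg_involutive, List.mem_reverse]

theorem nodup_negRev {t : List ℤ} (h : t.Nodup) : (negRev t).Nodup :=
  (List.nodup_reverse.2 h).map neg_injective

theorem negRev_cons (i : ℤ) (t : List ℤ) : negRev (i :: t) = negRev t ++ [-i] := by
  simp [negRev]

theorem negRev_reverse (t : List ℤ) : negRev t.reverse = (negRev t).reverse := by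
  simp [negRev]

theorem IsPermutationOf.mem_or_mem_iff {a b : ℤ} {l s : List ℤ}
    (h : IsPermutationOf (l ++ [a] ++ s) a b) {i : ℤ} : i ∈ l ∨ i ∈ s ↔ a < i ∧ i ≤ b := by
  have hi := h.2 i
  have ha : a ∉ l ∧ a ∉ s := by
    have hnodup := h.1
    grind [List.nodup_append, List.nodup_cons]
  rw [List.append_assoc, List.mem_append, List.mem_append, List.mem_singleton] at hi
  constructor
  · intro hmem
    have hne : i ≠ a := by rintro rfl; tauto
    exact ⟨(hi.1 (by tauto)).1.lt_of_ne hne.symm, (hi.1 (by tauto)).2⟩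
  · rintro ⟨hlt, hle⟩
    have hmem := hi.2 ⟨hlt.le, hle⟩
    have hne := hlt.ne'
    tauto

theorem IsPermutationOf.negRev_append {m h : ℕ} {σ τl τr : List ℤ} (hσ : IsPermutationOf σ 0 h)
    (hτ : IsPermutationOf (τl ++ [-(m : ℤ)] ++ τr) (-m) (-h - 1)) :
    IsPermutationOf (negRev τl ++ σ ++ negRev τr) 0 (m - 1) := by
  have hlast := (hτ.2 (-m)).1 (by simp)
  have hmemσ := hσ.2
  have hmem {i : ℤ} : i ∈ negRev τl ∨ i ∈ negRev τr ↔ h < i ∧ i < m := by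
    rw [mem_negRev, mem_negRev, hτ.mem_or_mem_iff]
    omega
  have hnodup : τl.Nodup ∧ τr.Nodup ∧ ∀ i ∈ τl, i ∉ τr := by
    have hnodup := hτ.1
    grind [List.nodup_append, List.nodup_cons]
  constructor
  · rw [List.append_assoc, List.nodup_append', List.nodup_append', List.disjoint_append_right]
    refine ⟨nodup_negRev hnodup.1, ⟨hσ.1, nodup_negRev hnodup.2.1, fun i hi hi' => ?_⟩,
      fun i hi hi' => ?_, fun i hi hi' => ?_⟩
    · have := hmem.1 (Or.inr hi')
      have := (hmemσ i).1 hi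
      omega
    · have := hmem.1 (Or.inl hi)
      have := (hmemσ i).1 hi'
      omega
    · exact hnodup.2.2 _ (mem_negRev.1 hi) (mem_negRev.1 hi')
  · intro i
    rw [List.mem_append, List.mem_append, or_right_comm, hmem, hmemσ]
    omega

end NegRev

section Products

variable {m n r : ℕ}

theorem reg_bigElemProd {t : List ℤ} {Y : List (Matrix (Fin n) (Fin n) ℂ)} {j : ℕ}
    (ht : ∀ i ∈ t, j ≠ i.natAbs ∧ j + 1 ≠ i.natAbs) (x : BlockVec m n r) :
    reg (const (bigElemProd m r t Y) *ᵥ x) j = reg x j := by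
  rw [bigElemProd]
  induction t generalizing Y with
  | nil => simp
  | cons i t ih =>
    rcases Y with _ | ⟨Y, Ys⟩
    · simp
    · rw [List.forall_mem_cons] at ht
      rw [List.zipWith_cons_cons, const_prod_cons_mulVec, reg_bigElem_other _ ht.1.1 ht.1.2,
        ih ht.2]

theorem statePart_bigElemProd (t : List ℤ) (Y : List (Matrix (Fin n) (Fin n) ℂ))
    (x : BlockVec m n r) : statePart (const (bigElemProd m r t Y) *ᵥ x) = statePart x := by
  rw [bigElemProd]
  induction t generalizing Y with
  | nil => simp
  | cons i t ih =>
    rcases Y with _ | ⟨Y, Ys⟩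
    · simp
    · rw [List.zipWith_cons_cons, const_prod_cons_mulVec, statePart_bigElem, ih]

theorem reg_act_bigElemProd (R : Realization m n r) {s t : List ℤ}
    {Y : List (Matrix (Fin n) (Fin n) ℂ)} (hY : Y.length = t.length)
    (hs : ∀ i ∈ s, 0 ≤ i ∧ i < m) (ht : ∀ i ∈ t, 0 ≤ i ∧ i < m) {p : ℕ}
    (h : SIP ((p : ℤ) :: (s ++ t))) (x : BlockVec m n r) :
    reg (R.act s (const (bigElemProd m r t Y) *ᵥ x)) p = reg x (greedyRun p (s ++ t)) := by
  let L : List (ℤ × Matrix ((Fin m × Fin n) ⊕ Fin r) ((Fin m × Fin n) ⊕ Fin r) ℂ) :=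
    s.map (fun i => (i, R.fiedlerS i)) ++ (t.zip Y).map (fun q => (q.1, bigElem m r q.1 q.2))
  have hindex : L.map Prod.fst = s ++ t := by
    have hzip : ((t.zip Y).map fun q => (q.1, bigElem m r q.1 q.2)).map Prod.fst = t := by
      rw [List.map_map]
      exact List.map_fst_zip hY.ge
    rw [List.map_append, hzip, List.map_map]
    exact congrArg (· ++ t) s.map_id
  have hprod : (L.map Prod.snd).prod = R.fiedlerSProd s * bigElemProd m r t Y := by
    rw [List.map_append, List.map_map, List.map_map, List.prod_append, bigElemProd,
      Realization.fiedlerSProd, ← List.map_uncurry_zip_eq_zipWith]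
    rfl
  have hgate : ∀ q ∈ L, IsGate q.1 q.2 := by
    rw [List.forall_mem_append, List.forall_mem_map, List.forall_mem_map]
    refine ⟨fun i hi => isGate_fiedlerS R (hs i hi).1 (hs i hi).2, fun q hq => ?_⟩
    have hi := ht q.1 (List.of_mem_zip hq).1
    exact isGate_bigElem hi.1 hi.2 q.2
  have hreg := reg_gates_greedyRun L hgate p (by rwa [hindex]) x
  rwa [hindex, hprod, const_mul, ← Matrix.mulVec_mulVec] at hreg

end Products

namespace Realization

variable {m n r : ℕ} (R : Realization m n r)

theorem fiedlerSProd_singleton (i : ℤ) : R.fiedlerSProd [i] = R.fiedlerS i :=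
  List.prod_singleton

theorem fiedlerS_mul_neg {i : ℤ} (h : -(m : ℤ) < i) (h' : i < 0) :
    R.fiedlerS i * R.fiedlerS (-i) = 1 := by
  obtain ⟨k, rfl⟩ : ∃ k : ℕ, i = -k := ⟨i.natAbs, by omega⟩
  rw [R.fiedlerS_neg (by omega) (by omega), neg_neg]
  exact Matrix.nonsing_inv_mul _ (isUnit_iff_ne_zero.2 (R.det_fiedlerS_pos (by omega) (by omega)))

theorem fiedlerSProd_mul_negRev {t : List ℤ} (ht : ∀ i ∈ t, -(m : ℤ) < i ∧ i < 0) :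
    R.fiedlerSProd t * R.fiedlerSProd (negRev t) = 1 := by
  induction t with
  | nil => simp [fiedlerSProd, negRev]
  | cons i t ih =>
    rw [List.forall_mem_cons] at ht
    rw [negRev_cons, ← List.singleton_append, fiedlerSProd_append, fiedlerSProd_append,
      fiedlerSProd_singleton, fiedlerSProd_singleton, Matrix.mul_assoc,
      ← Matrix.mul_assoc (R.fiedlerSProd t), ih ht.2, Matrix.one_mul,
      R.fiedlerS_mul_neg ht.1.1 ht.1.2]

theorem fiedlerSProd_negRev_mul {t : List ℤ} (ht : ∀ i ∈ t, -(m : ℤ) < i ∧ i < 0) :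
    R.fiedlerSProd (negRev t) * R.fiedlerSProd t = 1 :=
  mul_eq_one_comm.1 (R.fiedlerSProd_mul_negRev ht)

theorem det_fiedlerSProd_ne_zero {t : List ℤ} (ht : ∀ i ∈ t, -(m : ℤ) < i ∧ i < 0) :
    (R.fiedlerSProd t).det ≠ 0 :=
  Matrix.det_ne_zero_of_right_inverse (R.fiedlerSProd_mul_negRev ht)

theorem smul_fiedlerSProd_sub_fiedlerSProd {τl τr : List ℤ} (σ : List ℤ)
    (hl : ∀ i ∈ τl, -(m : ℤ) < i ∧ i < 0) (hr : ∀ i ∈ τr, -(m : ℤ) < i ∧ i < 0) :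
    (X : ℂ[X]) • const (R.fiedlerSProd (τl ++ [-(m : ℤ)] ++ τr)) - const (R.fiedlerSProd σ) =
      const (R.fiedlerSProd τl) * R.fiedlerPencil (negRev τl ++ σ ++ negRev τr) *
        const (R.fiedlerSProd τr) := by
  have hσ : R.fiedlerSProd τl * R.fiedlerSProd (negRev τl ++ σ ++ negRev τr) *
      R.fiedlerSProd τr = R.fiedlerSProd σ := by
    rw [fiedlerSProd_append, fiedlerSProd_append, Matrix.mul_assoc, Matrix.mul_assoc,
      R.fiedlerSProd_negRev_mul hr, Matrix.mul_one, ← Matrix.mul_assoc,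
      R.fiedlerSProd_mul_negRev hl, Matrix.one_mul]
  rw [fiedlerPencil, Matrix.mul_sub, Matrix.sub_mul, Matrix.mul_smul, Matrix.smul_mul,
    ← const_mul, ← const_mul, ← const_mul, ← const_mul, hσ, fiedlerSProd_append,
    fiedlerSProd_append, fiedlerSProd_singleton]

end Realization

/-- The index tuples for which the pencil is strictly equivalent to a Fiedler pencil: the entries
are restricted as in `IsGFPRIndices`, except that `σ₁` and `σ₂` may contain `h`. -/
structure IsPencilIndices (m h : ℕ) (σ τ σ₁ σ₂ τ₁ τ₂ : List ℤ) : Prop where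
  h_lt : h < m
  perm_σ : IsPermutationOf σ 0 h
  perm_τ : IsPermutationOf τ (-(m : ℤ)) (-(h : ℤ) - 1)
  mem_σ₁ : ∀ i ∈ σ₁, 0 ≤ i ∧ i ≤ (h : ℤ)
  mem_σ₂ : ∀ i ∈ σ₂, 0 ≤ i ∧ i ≤ (h : ℤ)
  mem_τ₁ : ∀ i ∈ τ₁, -(m : ℤ) ≤ i ∧ i ≤ -(h : ℤ) - 2
  mem_τ₂ : ∀ i ∈ τ₂, -(m : ℤ) ≤ i ∧ i ≤ -(h : ℤ) - 2

theorem IsGFPRIndices.isPencilIndices {m h : ℕ} {σ τ σ₁ σ₂ τ₁ τ₂ : List ℤ}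
    (hidx : IsGFPRIndices m h σ τ σ₁ σ₂ τ₁ τ₂) : IsPencilIndices m h σ τ σ₁ σ₂ τ₁ τ₂ where
  h_lt := hidx.h_lt
  perm_σ := hidx.perm_σ
  perm_τ := hidx.perm_τ
  mem_σ₁ i hi := ⟨(hidx.mem_σ₁ i hi).1, (hidx.mem_σ₁ i hi).2.trans (sub_le_self _ one_pos.le)⟩
  mem_σ₂ i hi := ⟨(hidx.mem_σ₂ i hi).1, (hidx.mem_σ₂ i hi).2.trans (sub_le_self _ one_pos.le)⟩
  mem_τ₁ := hidx.mem_τ₁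
  mem_τ₂ := hidx.mem_τ₂

theorem IsPencilIndices.exists_eq_append {m h : ℕ} {σ τ σ₁ σ₂ τ₁ τ₂ : List ℤ}
    (hidx : IsPencilIndices m h σ τ σ₁ σ₂ τ₁ τ₂) : ∃ τl τr, τ = τl ++ [-(m : ℤ)] ++ τr := by
  have hlt := hidx.h_lt
  obtain ⟨τl, τr, hτ⟩ := List.append_of_mem ((hidx.perm_τ.2 (-m)).2 ⟨le_rfl, by omega⟩)
  exact ⟨τl, τr, by rw [hτ, List.append_cons]⟩

section RightRecovery

variable {m n r h : ℕ} (R : Realization m n r) {σ τl τr σ₁ σ₂ τ₁ τ₂ : List ℤ}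
  {X₁ X₂ Y₁ Y₂ : List (Matrix (Fin n) (Fin n) ℂ)}

namespace IsPencilIndices

variable (hidx : IsPencilIndices m h σ (τl ++ [-(m : ℤ)] ++ τr) σ₁ σ₂ τ₁ τ₂)
include hidx

theorem mem_left : ∀ i ∈ τl, -(m : ℤ) < i ∧ i < 0 := fun i hi => by
  have := hidx.perm_τ.mem_or_mem_iff.1 (Or.inl hi)
  omega

theorem mem_right : ∀ i ∈ τr, -(m : ℤ) < i ∧ i < 0 := fun i hi => by
  have := hidx.perm_τ.mem_or_mem_iff.1 (Or.inr hi)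
  omega

theorem det_left_ne_zero (hX₁ : IsNonsingularAssignment m σ₁ X₁)
    (hY₁ : IsNonsingularAssignment m τ₁ Y₁) :
    (bigElemProd m r τ₁ Y₁ * bigElemProd m r σ₁ X₁ * R.fiedlerSProd τl).det ≠ 0 := by
  have hlt := hidx.h_lt
  have hσ₁ := det_bigElemProd_ne_zero (r := r)
    (fun i hi => by have := hidx.mem_σ₁ i hi; omega) hX₁
  have hτ₁ := det_bigElemProd_ne_zero (r := r)
    (fun i hi => by have := hidx.mem_τ₁ i hi; omega) hY₁
  rw [Matrix.det_mul, Matrix.det_mul]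
  exact mul_ne_zero (mul_ne_zero hτ₁ hσ₁) (R.det_fiedlerSProd_ne_zero hidx.mem_left)

theorem det_right_ne_zero (hX₂ : IsNonsingularAssignment m σ₂ X₂)
    (hY₂ : IsNonsingularAssignment m τ₂ Y₂) :
    (R.fiedlerSProd τr * (bigElemProd m r σ₂ X₂ * bigElemProd m r τ₂ Y₂)).det ≠ 0 := by
  have hlt := hidx.h_lt
  have hσ₂ := det_bigElemProd_ne_zero (r := r)
    (fun i hi => by have := hidx.mem_σ₂ i hi; omega) hX₂
  have hτ₂ := det_bigElemProd_ne_zero (r := r)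
    (fun i hi => by have := hidx.mem_τ₂ i hi; omega) hY₂
  rw [Matrix.det_mul, Matrix.det_mul]
  exact mul_ne_zero (R.det_fiedlerSProd_ne_zero hidx.mem_right) (mul_ne_zero hσ₂ hτ₂)

theorem pencil_eq : pencil R σ (τl ++ [-(m : ℤ)] ++ τr) σ₁ σ₂ τ₁ τ₂ X₁ X₂ Y₁ Y₂ =
    const (bigElemProd m r τ₁ Y₁ * bigElemProd m r σ₁ X₁ * R.fiedlerSProd τl) *
      R.fiedlerPencil (negRev τl ++ σ ++ negRev τr) *
      const (R.fiedlerSProd τr * (bigElemProd m r σ₂ X₂ * bigElemProd m r τ₂ Y₂)) := by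
  rw [pencil, R.smul_fiedlerSProd_sub_fiedlerSProd σ hidx.mem_left hidx.mem_right]
  simp only [const_mul, Matrix.mul_assoc]

theorem greedyRun_append_le {l s : List ℤ} (hσ : σ = l ++ 0 :: s) :
    greedyRun 0 (s ++ σ₂) ≤ h :=
  greedyRun_le (Nat.zero_le h) <| List.forall_mem_append.2
    ⟨fun i hi => ((hidx.perm_σ.2 i).1 (by simp [hσ, hi])).2, fun i hi => (hidx.mem_σ₂ i hi).2⟩

theorem reg_act_bigElemProd_mul {l s : List ℤ} (hσ : σ = l ++ 0 :: s)
    (hX₂ : X₂.length = σ₂.length) (hsip : SIP (σ ++ σ₂)) (x : BlockVec m n r) :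
    reg (R.act s (const (bigElemProd m r σ₂ X₂ * bigElemProd m r τ₂ Y₂) *ᵥ x)) 0 =
      reg x (greedyRun 0 (s ++ σ₂)) := by
  have hlt := hidx.h_lt
  have hs : ∀ i ∈ s, 0 ≤ i ∧ i ≤ (h : ℤ) := fun i hi => (hidx.perm_σ.2 i).1 (by simp [hσ, hi])
  have hrun := hidx.greedyRun_append_le hσ
  rw [hσ, List.append_assoc] at hsip
  rw [const_mul, ← Matrix.mulVec_mulVec, reg_act_bigElemProd R (p := 0) hX₂
    (fun i hi => by have := hs i hi; omega) (fun i hi => by have := hidx.mem_σ₂ i hi; omega)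
    hsip.of_append_right]
  exact reg_bigElemProd (fun i hi => by have := hidx.mem_τ₂ i hi; omega) x

theorem fiedlerSProd_after_zero_mul {l s : List ℤ} (hσ : σ = l ++ 0 :: s) (hl : 0 ∉ l) :
    R.fiedlerSProd (after 0 (negRev τl ++ σ ++ negRev τr)) * R.fiedlerSProd τr =
      R.fiedlerSProd s := by
  have hτl : 0 ∉ negRev τl ++ l := by
    rw [List.mem_append, mem_negRev, neg_zero, not_or]
    exact ⟨fun h0 => (hidx.mem_left 0 h0).2.false, hl⟩
  have hsplit : negRev τl ++ σ ++ negRev τr = negRev τl ++ l ++ 0 :: (s ++ negRev τr) := by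
    simp [hσ]
  rw [hsplit, after_append_cons hτl, R.fiedlerSProd_append, Matrix.mul_assoc,
    R.fiedlerSProd_negRev_mul hidx.mem_right, Matrix.mul_one]

theorem recoveryMatrix_eq (hX₂ : X₂.length = σ₂.length) (hsip : SIP (σ ++ σ₂)) :
    recoveryMatrix m n r (m - consecutionsAt 0 (σ ++ σ₂)) =
      recoveryMatrix m n r m *
        const (R.fiedlerSProd (after 0 (negRev τl ++ σ ++ negRev τr))) *
        const (R.fiedlerSProd τr * (bigElemProd m r σ₂ X₂ * bigElemProd m r τ₂ Y₂)) := by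
  obtain ⟨l, s, hσ, -, hl, hs⟩ :=
    exists_split_after hidx.perm_σ.1 ((hidx.perm_σ.2 0).2 ⟨le_rfl, Int.natCast_nonneg h⟩)
  have hspos : ∀ i ∈ s, 0 < i := fun i hi =>
    (hidx.perm_σ.nonneg i (by simp [hσ, hi])).lt_of_ne fun h0 => hs (h0 ▸ hi)
  have hrun := hidx.greedyRun_append_le hσ
  have hc : consecutionsAt 0 (σ ++ σ₂) = greedyRun 0 (s ++ σ₂) := by
    rw [hσ, List.append_assoc, List.cons_append, consecutionsAt_zero hl]
  refine Matrix.mulVec_injective (funext fun x => ?_)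
  have hzero := recoveryMatrix_mulVec hidx.h_lt.pos
    (R.act s (const (bigElemProd m r σ₂ X₂ * bigElemProd m r τ₂ Y₂) *ᵥ x))
  rw [Nat.cast_zero, sub_zero, hidx.reg_act_bigElemProd_mul R hσ hX₂ hsip, R.statePart_act hspos,
    const_mul, ← Matrix.mulVec_mulVec, statePart_bigElemProd, statePart_bigElemProd] at hzero
  rw [hc, recoveryMatrix_mulVec (hrun.trans_lt hidx.h_lt), Matrix.mul_assoc, ← const_mul,
    ← Matrix.mul_assoc (R.fiedlerSProd _), hidx.fiedlerSProd_after_zero_mul R hσ hl, const_mul,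
    ← Matrix.mulVec_mulVec, ← Matrix.mulVec_mulVec, const_mul, ← Matrix.mulVec_mulVec, ← hzero]
  rfl

theorem isDegreeShift_pencil (hX₁ : IsNonsingularAssignment m σ₁ X₁)
    (hX₂ : IsNonsingularAssignment m σ₂ X₂) (hY₁ : IsNonsingularAssignment m τ₁ Y₁)
    (hY₂ : IsNonsingularAssignment m τ₂ Y₂) (hsip : SIP (σ ++ σ₂)) :
    IsDegreeShift (recoveryMatrix m n r (m - consecutionsAt 0 (σ ++ σ₂)))
      (totalInversions (negRev τl ++ σ ++ negRev τr))
      (rightNull (toRat (pencil R σ (τl ++ [-(m : ℤ)] ++ τr) σ₁ σ₂ τ₁ τ₂ X₁ X₂ Y₁ Y₂)))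
      (rightNull (toRat R.systemMatrix)) := by
  rw [hidx.recoveryMatrix_eq R hX₂.1 hsip, hidx.pencil_eq]
  exact (R.isDegreeShift_fiedlerPencil hidx.h_lt.pos
    (hidx.perm_σ.negRev_append hidx.perm_τ)).comp (isDegreeShift_const
    (hidx.det_left_ne_zero R hX₁ hY₁) (hidx.det_right_ne_zero R hX₂ hY₂) _)

end IsPencilIndices

end RightRecovery

/-! ### Transposition -/

section Transpose

variable {m n r : ℕ}

theorem const_transpose {ι κ : Type*} (M : Matrix ι κ ℂ) : const Mᵀ = (const M)ᵀ :=
  rfl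

theorem leftNull_toRat {ι κ : Type*} [Fintype ι] [Fintype κ] (M : Matrix ι κ ℂ[X]) :
    leftNull (toRat M) = rightNull (toRat Mᵀ) := by
  ext x
  rw [leftNull, rightNull, LinearMap.mem_ker, LinearMap.mem_ker, Matrix.mulVecLin_apply,
    Matrix.vecMulLinear_apply, ← Matrix.mulVec_transpose]
  rfl

theorem elemBlocks_transpose (i : ℤ) (Y : Matrix (Fin n) (Fin n) ℂ) (a b : Fin m) :
    elemBlocks m i Yᵀ a b = (elemBlocks m i Y b a)ᵀ := by
  unfold elemBlocks
  split_ifs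
  iterate 2
    rw [Matrix.diagonal_apply, Matrix.diagonal_apply]
    grind [Matrix.transpose_one, Matrix.transpose_zero]
  all_goals
    simp only [Matrix.of_apply, apply_ite Matrix.transpose, Matrix.transpose_one,
      Matrix.transpose_zero]
    grind

theorem elem_transpose (i : ℤ) (Y : Matrix (Fin n) (Fin n) ℂ) : (elem m i Y)ᵀ = elem m i Yᵀ := by
  ext ⟨a, k⟩ ⟨b, l⟩
  simp only [elem, Matrix.transpose_apply, Matrix.comp_apply, elemBlocks_transpose]

theorem bigElem_transpose (i : ℤ) (Y : Matrix (Fin n) (Fin n) ℂ) :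
    (bigElem m r i Y)ᵀ = bigElem m r i Yᵀ := by
  rw [bigElem, bigElem, Matrix.fromBlocks_transpose, Matrix.transpose_zero, Matrix.transpose_zero,
    Matrix.transpose_one, elem_transpose]

theorem bigElemProd_transpose {t : List ℤ} {Y : List (Matrix (Fin n) (Fin n) ℂ)}
    (h : Y.length = t.length) :
    (bigElemProd m r t Y)ᵀ = bigElemProd m r t.reverse (Y.map Matrix.transpose).reverse := by
  rw [bigElemProd, bigElemProd, Matrix.transpose_list_prod,
    ← List.reverse_zipWith (by rw [List.length_map, h]), List.map_zipWith, List.zipWith_map_right]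
  simp only [bigElem_transpose]

theorem IsNonsingularAssignment.transpose_reverse {t : List ℤ}
    {Y : List (Matrix (Fin n) (Fin n) ℂ)} (h : IsNonsingularAssignment m t Y) :
    IsNonsingularAssignment m t.reverse (Y.map Matrix.transpose).reverse := by
  refine ⟨by simpa using h.1, fun q hq hq' => ?_⟩
  rw [List.zip, ← List.reverse_zipWith (by rw [List.length_map, h.1]), List.mem_reverse,
    ← List.zip, List.zip_map_right, List.mem_map] at hq
  obtain ⟨q', hmem, rfl⟩ := hq
  rw [Prod.map_snd, Matrix.det_transpose]
  exact h.2 q' hmem hq'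

namespace Realization

/-- The realization of the transposed rational matrix. -/
def transpose (R : Realization m n r) : Realization m n r where
  coeff k := (R.coeff k)ᵀ
  A := R.Aᵀ
  E := R.Eᵀ
  B := R.Cᵀ
  C := R.Bᵀ
  E_nonsingular := by rw [Matrix.det_transpose]; exact R.E_nonsingular

variable (R : Realization m n r)

theorem systemMatrix_transpose : R.systemMatrixᵀ = R.transpose.systemMatrix := by
  rw [systemMatrix, systemMatrix, Matrix.fromBlocks_transpose]
  congr 1
  simp [polyPart, transpose, const_transpose, Matrix.transpose_sum]

theorem fiedlerP_transpose (i : ℤ) : (R.fiedlerP i)ᵀ = R.transpose.fiedlerP i := by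
  unfold fiedlerP
  split_ifs <;> simp [elem_transpose, transpose]

theorem fiedlerS_transpose (i : ℤ) : (R.fiedlerS i)ᵀ = R.transpose.fiedlerS i := by
  unfold fiedlerS
  split_ifs
  · rw [Matrix.fromBlocks_transpose, fiedlerP_transpose]
    congr 1
  · rw [Matrix.fromBlocks_transpose, fiedlerP_transpose]
    congr 1
  · rw [Matrix.fromBlocks_transpose, fiedlerP_transpose, Matrix.transpose_zero,
      Matrix.transpose_zero, Matrix.transpose_one]
  · rw [Matrix.transpose_nonsing_inv, Matrix.fromBlocks_transpose, fiedlerP_transpose,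
      Matrix.transpose_zero, Matrix.transpose_zero, Matrix.transpose_one]

theorem fiedlerSProd_transpose (t : List ℤ) :
    (R.fiedlerSProd t)ᵀ = R.transpose.fiedlerSProd t.reverse := by
  rw [fiedlerSProd, fiedlerSProd, Matrix.transpose_list_prod, List.map_map, List.map_reverse]
  simp only [Function.comp_def, fiedlerS_transpose]

theorem pencil_transpose {σ τ σ₁ σ₂ τ₁ τ₂ : List ℤ}
    {X₁ X₂ Y₁ Y₂ : List (Matrix (Fin n) (Fin n) ℂ)}
    (hX₁ : X₁.length = σ₁.length) (hX₂ : X₂.length = σ₂.length)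
    (hY₁ : Y₁.length = τ₁.length) (hY₂ : Y₂.length = τ₂.length) :
    (pencil R σ τ σ₁ σ₂ τ₁ τ₂ X₁ X₂ Y₁ Y₂)ᵀ =
      pencil R.transpose σ.reverse τ.reverse σ₂.reverse σ₁.reverse τ₂.reverse τ₁.reverse
        (X₂.map Matrix.transpose).reverse (X₁.map Matrix.transpose).reverse
        (Y₂.map Matrix.transpose).reverse (Y₁.map Matrix.transpose).reverse := by
  simp only [pencil, Matrix.transpose_mul, Matrix.transpose_sub, Matrix.transpose_smul,
    ← const_transpose, bigElemProd_transpose, fiedlerSProd_transpose, hX₁, hX₂, hY₁, hY₂,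
    Matrix.mul_assoc]

end Realization

theorem IsPermutationOf.reverse {t : List ℤ} {a b : ℤ} (h : IsPermutationOf t a b) :
    IsPermutationOf t.reverse a b :=
  ⟨List.nodup_reverse.2 h.1, fun i => by rw [List.mem_reverse, h.2]⟩

theorem consecutionsAt_reverse (t : ℤ) (α : List ℤ) :
    consecutionsAt t α.reverse = inversionsAt t α := by
  have h (p : ℕ) : (run t p).Sublist α.reverse ↔ (run t p).reverse.Sublist α := by
    rw [← List.reverse_sublist, List.reverse_reverse]
  simp only [consecutionsAt, inversionsAt, List.mem_reverse, List.length_reverse, h]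

theorem totalInversions_reverse (α : List ℤ) :
    totalInversions α.reverse = totalConsecutions α := by
  have h (i : ℤ) : [i + 1, i].Sublist α.reverse ↔ [i, i + 1].Sublist α := by
    rw [← List.reverse_sublist, List.reverse_reverse]
    rfl
  simp only [totalInversions, totalConsecutions, List.toFinset_reverse, h]

namespace IsPencilIndices

theorem reverse {h : ℕ} {σ τ σ₁ σ₂ τ₁ τ₂ : List ℤ} (hidx : IsPencilIndices m h σ τ σ₁ σ₂ τ₁ τ₂) :
    IsPencilIndices m h σ.reverse τ.reverse σ₂.reverse σ₁.reverse τ₂.reverse τ₁.reverse where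
  h_lt := hidx.h_lt
  perm_σ := hidx.perm_σ.reverse
  perm_τ := hidx.perm_τ.reverse
  mem_σ₁ i hi := hidx.mem_σ₂ i (List.mem_reverse.1 hi)
  mem_σ₂ i hi := hidx.mem_σ₁ i (List.mem_reverse.1 hi)
  mem_τ₁ i hi := hidx.mem_τ₂ i (List.mem_reverse.1 hi)
  mem_τ₂ i hi := hidx.mem_τ₁ i (List.mem_reverse.1 hi)

theorem isDegreeShift_pencil_left (R : Realization m n r) {h : ℕ}
    {σ τl τr σ₁ σ₂ τ₁ τ₂ : List ℤ} {X₁ X₂ Y₁ Y₂ : List (Matrix (Fin n) (Fin n) ℂ)}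
    (hidx : IsPencilIndices m h σ (τl ++ [-(m : ℤ)] ++ τr) σ₁ σ₂ τ₁ τ₂)
    (hX₁ : IsNonsingularAssignment m σ₁ X₁) (hX₂ : IsNonsingularAssignment m σ₂ X₂)
    (hY₁ : IsNonsingularAssignment m τ₁ Y₁) (hY₂ : IsNonsingularAssignment m τ₂ Y₂)
    (hsip : SIP (σ₁ ++ σ)) :
    IsDegreeShift (recoveryMatrix m n r (m - inversionsAt 0 (σ₁ ++ σ)))
      (totalConsecutions (negRev τl ++ σ ++ negRev τr))
      (leftNull (toRat (pencil R σ (τl ++ [-(m : ℤ)] ++ τr) σ₁ σ₂ τ₁ τ₂ X₁ X₂ Y₁ Y₂)))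
      (leftNull (toRat R.systemMatrix)) := by
  have hτ : (τl ++ [-(m : ℤ)] ++ τr).reverse = τr.reverse ++ [-(m : ℤ)] ++ τl.reverse := by simp
  have hα : negRev τr.reverse ++ σ.reverse ++ negRev τl.reverse =
      (negRev τl ++ σ ++ negRev τr).reverse := by simp [negRev_reverse]
  have hidx' := hidx.reverse
  rw [hτ] at hidx'
  have hshift := hidx'.isDegreeShift_pencil R.transpose hX₂.transpose_reverse
    hX₁.transpose_reverse hY₂.transpose_reverse hY₁.transpose_reverse
    (List.reverse_append ▸ hsip.reverse)
  rwa [← List.reverse_append, consecutionsAt_reverse, hα, totalInversions_reverse, ← hτ,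
    ← R.pencil_transpose hX₁.1 hX₂.1 hY₁.1 hY₂.1, ← R.systemMatrix_transpose, ← leftNull_toRat,
    ← leftNull_toRat] at hshift

end IsPencilIndices

end Transpose

end GFPR

theorem theorem5p3_general {m n r : ℕ} (R : Realization m n r) (h : ℕ) (σ τ σ₁ σ₂ τ₁ τ₂ : List ℤ)
    (hidx : IsPencilIndices m h σ τ σ₁ σ₂ τ₁ τ₂) (hsip₁ : SIP (σ₁ ++ σ)) (hsip₂ : SIP (σ ++ σ₂))
    (X₁ X₂ Y₁ Y₂ : List (Matrix (Fin n) (Fin n) ℂ))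
    (hX₁ : IsNonsingularAssignment m σ₁ X₁) (hX₂ : IsNonsingularAssignment m σ₂ X₂)
    (hY₁ : IsNonsingularAssignment m τ₁ Y₁) (hY₂ : IsNonsingularAssignment m τ₂ Y₂) :
    (∀ (p : ℕ) (Zmn : Matrix (Fin m × Fin n) (Fin p) ℂ[X]) (Zr : Matrix (Fin r) (Fin p) ℂ[X]),
      (IsRightMinimalBasis (pencil R σ τ σ₁ σ₂ τ₁ τ₂ X₁ X₂ Y₁ Y₂) (Matrix.fromRows Zmn Zr) →
        IsRightMinimalBasis R.systemMatrix
          (Matrix.fromRows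
            (blockRow m ((m : ℤ) - consecutionsAt 0 (σ ++ σ₂))
              (1 : Matrix (Fin n) (Fin n) ℂ[X]) * Zmn) Zr)) ∧
      (IsLeftMinimalBasis (pencil R σ τ σ₁ σ₂ τ₁ τ₂ X₁ X₂ Y₁ Y₂) (Matrix.fromRows Zmn Zr) →
        IsLeftMinimalBasis R.systemMatrix
          (Matrix.fromRows
            (blockRow m ((m : ℤ) - inversionsAt 0 (σ₁ ++ σ))
              (1 : Matrix (Fin n) (Fin n) ℂ[X]) * Zmn) Zr))) ∧
    (∀ τl τr α : List ℤ, τ = τl ++ [-(m : ℤ)] ++ τr → α = negRev τl ++ σ ++ negRev τr →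
      ∀ (p : ℕ) (ε : Fin p → ℤ),
        (IsRightMinimalIndices (pencil R σ τ σ₁ σ₂ τ₁ τ₂ X₁ X₂ Y₁ Y₂) ε →
          IsRightMinimalIndices R.systemMatrix fun j => ε j - (totalInversions α : ℤ)) ∧
        (IsLeftMinimalIndices (pencil R σ τ σ₁ σ₂ τ₁ τ₂ X₁ X₂ Y₁ Y₂) ε →
          IsLeftMinimalIndices R.systemMatrix fun j => ε j - (totalConsecutions α : ℤ))) := by
  obtain ⟨τl, τr, rfl⟩ := hidx.exists_eq_append
  refine ⟨fun p Zmn Zr => ?_, ?_⟩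
  · rw [← recoveryMatrix_mul_fromRows, ← recoveryMatrix_mul_fromRows]
    exact ⟨(hidx.isDegreeShift_pencil R hX₁ hX₂ hY₁ hY₂ hsip₂).isMinimalBasis_mul,
      (hidx.isDegreeShift_pencil_left R hX₁ hX₂ hY₁ hY₂ hsip₁).isMinimalBasis_mul⟩
  · rintro τl' τr' α hτ rfl p ε
    rw [hτ] at hidx ⊢
    exact ⟨(hidx.isDegreeShift_pencil R hX₁ hX₂ hY₁ hY₂ hsip₂).exists_isMinimalBasis,
      (hidx.isDegreeShift_pencil_left R hX₁ hX₂ hY₁ hY₂ hsip₁).exists_isMinimalBasis⟩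

theorem theorem5p3 {m n r : ℕ} (R : Realization m n r) (hAm : R.coeff m ≠ 0)
    (hmin : R.IsMinimal) (h : ℕ) (σ τ σ₁ σ₂ τ₁ τ₂ : List ℤ)
    (hidx : IsGFPRIndices m h σ τ σ₁ σ₂ τ₁ τ₂)
    (X₁ X₂ Y₁ Y₂ : List (Matrix (Fin n) (Fin n) ℂ))
    (hX₁ : IsNonsingularAssignment m σ₁ X₁) (hX₂ : IsNonsingularAssignment m σ₂ X₂)
    (hY₁ : IsNonsingularAssignment m τ₁ Y₁) (hY₂ : IsNonsingularAssignment m τ₂ Y₂) :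
    (∀ (p : ℕ) (Zmn : Matrix (Fin m × Fin n) (Fin p) ℂ[X]) (Zr : Matrix (Fin r) (Fin p) ℂ[X]),
      (IsRightMinimalBasis (pencil R σ τ σ₁ σ₂ τ₁ τ₂ X₁ X₂ Y₁ Y₂) (Matrix.fromRows Zmn Zr) →
        IsRightMinimalBasis R.systemMatrix
          (Matrix.fromRows
            (blockRow m ((m : ℤ) - consecutionsAt 0 (σ ++ σ₂))
              (1 : Matrix (Fin n) (Fin n) ℂ[X]) * Zmn) Zr)) ∧
      (IsLeftMinimalBasis (pencil R σ τ σ₁ σ₂ τ₁ τ₂ X₁ X₂ Y₁ Y₂) (Matrix.fromRows Zmn Zr) →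
        IsLeftMinimalBasis R.systemMatrix
          (Matrix.fromRows
            (blockRow m ((m : ℤ) - inversionsAt 0 (σ₁ ++ σ))
              (1 : Matrix (Fin n) (Fin n) ℂ[X]) * Zmn) Zr))) ∧
    (∀ τl τr α : List ℤ, τ = τl ++ [-(m : ℤ)] ++ τr → α = negRev τl ++ σ ++ negRev τr →
      ∀ (p : ℕ) (ε : Fin p → ℤ),
        (IsRightMinimalIndices (pencil R σ τ σ₁ σ₂ τ₁ τ₂ X₁ X₂ Y₁ Y₂) ε →
          IsRightMinimalIndices R.systemMatrix fun j => ε j - (totalInversions α : ℤ)) ∧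
        (IsLeftMinimalIndices (pencil R σ τ σ₁ σ₂ τ₁ τ₂ X₁ X₂ Y₁ Y₂) ε →
          IsLeftMinimalIndices R.systemMatrix fun j => ε j - (totalConsecutions α : ℤ))) := by
  have hsip := hidx.sip_σ
  exact theorem5p3_general R h σ τ σ₁ σ₂ τ₁ τ₂ hidx.isPencilIndices hsip.of_append_left
    (List.append_assoc σ₁ σ σ₂ ▸ hsip).of_append_right X₁ X₂ Y₁ Y₂ hX₁ hX₂ hY₁ hY₂
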